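/- All graphs are finite, simple and undirected; $V(G)$ and $E(G)$ are the vertex and edge sets of $G$. **Decompositions.** For graphs $G$ and $H$, an $H$-decomposition of $G$ is a family of bags $(B_x\subseteq V(G):x\in V(H))$ such that the ends of each edge of $G$ lie in a common bag and, for each $v\in V(G)$, the set $\{x\in V(H):v\in B_x\}$ induces a non-empty connected subgraph of $H$. Its width is the size of the largest bag minus $1$. If $H$ is a tree it is a tree decomposition; the treewidth of $G$ is the minimum width of a tree decomposition of $G$. **Layerings.** A layering of $G$ is a partition $(V_0,V_1,\dots,V_t)$ of $V(G)$ (parts may be empty) such that $|i-j|\le 1$ for every edge $vw$ with $v\in V_i$, $w\in V_j$. A decomposition has layered width at most $\ell$ with respect to the layering if every bag contains at most $\ell$ vertices of every $V_i$. The layered treewidth of $G$ is the minimum $\ell$ such that some tree decomposition of $G$ has layered width at most $\ell$ with respect to some layering of $G$. The graph $G$ is $\ell$-good if for every clique $K$ of $G$ with $|K|\le\ell$ there is a tree decomposition of $G$ of layered width at most $\ell$ with respect to some layering of $G$ whose first layer is $V_0=K$. **Layered separations.** $G$ admits layered separations of width $\ell$ if there is a layering $(V_0,\dots,V_t)$ of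 $G$ such that for every $S\subseteq V(G)$ there are subgraphs $G_1,G_2$ of $G$ with $G=G_1\cup G_2$, such that each $V_i$ contains at most $\ell$ vertices of $G_1\cap G_2$, and both $V(G_1)\setminus V(G_2)$ and $V(G_2)\setminus V(G_1)$ contain at most $\frac23|S|$ vertices of $S$. **Strongly almost-embeddable graphs.** Let $k\ge1$. A graph $G$ is strongly $k$-almost-embeddable if there are a set $A\subseteq V(G)$ of at most $k$ apex vertices, an integer $s\in\{0,\dots,k\}$, and graphs $G_0,G_1,\dots,G_s$ such that: - $G-A=G_0\cup G_1\cup\dots\cup G_s$, and $G_1,\dots,G_s$ are pairwise vertex-disjoint; - $G_0$ is embedded in a surface of Euler genus at most $k$, and $F_1,\dots,F_s$ are pairwise vertex-disjoint facial cycles of this embedding; - for each $i\in\{1,\dots,s\}$, $V(G_0\cap G_i)=V(F_i)$ and $G_i$ has an $F_i$-decomposition $(B_x:x\in V(F_i))$ of width at most $k$ with $x\in B_x$ for each $x\in V(F_i)$; - no vertex of $A$ is adjacent to a vertex of $G_0$ that is in none of $G_1,\dots,G_s$. **Clique-sums.** A clique-sum of graphs $G_1$ and $G_2$ is a graph obtained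 from their disjoint union by identifying a clique of $G_1$ with a clique of $G_2$ of the same size, and possibly deleting some edges of this clique. A graph is obtained by clique-sums of graphs in a class if it is in the smallest class that contains them and is closed under clique-sums. **Theorem.** Let $k\ge 1$ be an integer, and let $G$ be a graph obtained by clique-sums of strongly $k$-almost-embeddable graphs. Then: (a) $G$ is $(4k^2+8k+3)$-good; (b) $G$ has layered treewidth at most $4k^2+8k+3$; (c) $G$ admits layered separations of width $4k^2+8k+3$; (d) if $G$ is connected and has diameter $d$, then $G$ has treewidth less than $(4k^2+8k+3)(d+1)$. -/

import Mathlib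

namespace LayeredSep

universe u v w

/-! ### Decompositions, layerings, layered width -/

/-- An `H`-decomposition of a graph `G`: bags of vertices of `G`, indexed by the vertices of `H`,
such that the two ends of each edge of `G` lie in a common bag and, for each vertex `v` of `G`, the
nodes whose bags contain `v` induce a non-empty connected subgraph of `H`
(`SimpleGraph.Connected` includes non-emptiness). -/
structure Decomposition {V : Type u} {W : Type v} (G : SimpleGraph V) (H : SimpleGraph W) where
  bag : W → Set V
  edge_mem : ∀ a b : V, G.Adj a b → ∃ x : W, a ∈ bag x ∧ b ∈ bag x
  connected : ∀ a : V, (H.induce {x : W | a ∈ bag x}).Connected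

/-- A layering of `G`: vertex `a` is in the layer with index `idx a`, and adjacent vertices are in
the same layer or in consecutive layers. (Layers may be empty; for a finite graph all but
finitely many are.) -/
structure Layering {V : Type u} (G : SimpleGraph V) where
  idx : V → ℕ
  adj_le : ∀ a b : V, G.Adj a b → idx a ≤ idx b + 1

/-- The layer `V_i`. -/
def Layering.layer {V : Type u} {G : SimpleGraph V} (L : Layering G) (i : ℕ) : Set V :=
  {a : V | L.idx a = i}

/-- The width of a decomposition: the size of its largest bag, minus 1. -/
noncomputable def Decomposition.width {V : Type u} {W : Type v} {G : SimpleGraph V}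
    {H : SimpleGraph W} (D : Decomposition G H) : ℕ∞ :=
  (⨆ x : W, (D.bag x).encard) - 1

/-- The layered width of a decomposition with respect to a given layering: the largest number of
vertices that a bag and a layer have in common. -/
noncomputable def Decomposition.layeredWidth {V : Type u} {W : Type v} {G : SimpleGraph V}
    {H : SimpleGraph W} (D : Decomposition G H) (L : Layering G) : ℕ∞ :=
  ⨆ (x : W) (i : ℕ), (D.bag x ∩ L.layer i).encard

/-- The treewidth: the minimum width of a tree decomposition. -/
noncomputable def treewidth {V : Type u} (G : SimpleGraph V) : ℕ∞ :=
  ⨅ (n : ℕ) (T : SimpleGraph (Fin n)) (_ : T.IsTree) (D : Decomposition G T), D.width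

/-- The layered treewidth: the minimum layered width of a tree decomposition, with respect to any
layering. -/
noncomputable def layeredTreewidth {V : Type u} (G : SimpleGraph V) : ℕ∞ :=
  ⨅ (n : ℕ) (T : SimpleGraph (Fin n)) (_ : T.IsTree) (D : Decomposition G T) (L : Layering G),
    D.layeredWidth L

/-- `G` is `l`-good: for every clique `K` of size at most `l` there are a layering with first layer
`K` and a tree decomposition whose layered width with respect to it is at most `l`. -/
def IsGood {V : Type u} (G : SimpleGraph V) (l : ℕ) : Prop :=
  ∀ K : Set V, G.IsClique K → K.encard ≤ l →
    ∃ (L : Layering G) (n : ℕ) (T : SimpleGraph (Fin n)) (D : Decomposition G T),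
      L.layer 0 = K ∧ T.IsTree ∧ D.layeredWidth L ≤ l

/-- `G` admits layered separations of width `l` with respect to the layering `L`: for every set `S`
of vertices there is a separation `(G₁, G₂)` (two subgraphs with union `G`) such that each layer
contains at most `l` vertices of `G₁ ∩ G₂`, and each of `V(G₁) - V(G₂)` and `V(G₂) - V(G₁)`
contains at most `2|S|/3` vertices of `S`. -/
def AdmitsLayeredSeparationsWrt {V : Type u} (G : SimpleGraph V) (L : Layering G) (l : ℕ) : Prop :=
  ∀ S : Set V, ∃ G₁ G₂ : G.Subgraph, G₁ ⊔ G₂ = ⊤ ∧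
    (∀ i : ℕ, (L.layer i ∩ (G₁ ⊓ G₂).verts).encard ≤ l) ∧
    3 * ((G₁.verts \ G₂.verts) ∩ S).encard ≤ 2 * S.encard ∧
    3 * ((G₂.verts \ G₁.verts) ∩ S).encard ≤ 2 * S.encard

/-- `G` admits layered separations of width `l` (with respect to some layering). -/
def AdmitsLayeredSeparations {V : Type u} (G : SimpleGraph V) (l : ℕ) : Prop :=
  ∃ L : Layering G, AdmitsLayeredSeparationsWrt G L l

/-! ### Graphs embedded in surfaces

An embedding of a graph in a surface, orientable or not, is given by its combinatorial map. Thicken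
each edge to a band and give its two sides the names `true` and `false`. A *flag* `(d, b)` is an end
of a side of an edge: side `b` of the edge underlying the dart `d`, at the end `d.fst`. At every
vertex, the corners between consecutive edges match up the flags at this vertex in pairs. -/

/-- The flag at the other end of the same side of the same edge. -/
def flagOpp {V : Type u} {G : SimpleGraph V} (x : G.Dart × Bool) : G.Dart × Bool :=
  (x.1.symm, x.2)

/-- The flag at the same end, on the other side, of the same edge. -/
def flagSide {V : Type u} {G : SimpleGraph V} (x : G.Dart × Bool) : G.Dart × Bool :=
  (x.1, !x.2)

/-- A (cellular) embedding of `G` in a surface: the fixed-point-free involution `turn` takes a flag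
to the other flag of the same corner. Both flags of a corner are at the same vertex, and the edges
and corners at a vertex form a single cyclic sequence around it. Each connected component of `G`
with an edge is thus embedded in a connected closed surface, each face being an open disc. -/
structure SurfaceEmbedding {V : Type u} (G : SimpleGraph V) where
  turn : G.Dart × Bool → G.Dart × Bool
  turn_turn : ∀ x, turn (turn x) = x
  turn_ne : ∀ x, turn x ≠ x
  turn_fst : ∀ x, (turn x).1.fst = x.1.fst
  rotation : ∀ x y : G.Dart × Bool, x.1.fst = y.1.fst →
    Relation.EqvGen (fun a b => b = turn a ∨ b = flagSide a) x y

/-- A face is an orbit of flags under following a side of an edge and turning at a corner. -/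
def SurfaceEmbedding.Face {V : Type u} {G : SimpleGraph V} (E : SurfaceEmbedding G) : Type u :=
  Quot (fun a b : G.Dart × Bool => b = E.turn a ∨ b = flagOpp a)

/-- The face whose boundary contains the flag `x`. -/
def SurfaceEmbedding.faceOf {V : Type u} {G : SimpleGraph V} (E : SurfaceEmbedding G)
    (x : G.Dart × Bool) : E.Face :=
  Quot.mk _ x

/-- The Euler genus `2c - (|V| - |E| + |F|)` of the surface in which the finite graph `G` is
embedded, where `c` is the number of components of `G`. Every component of `G` has its own
surface, and the Euler genera of these are added, which is the Euler genus of their connected sum.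
An isolated vertex lies on a sphere, with one face (which contains no flag). -/
noncomputable def SurfaceEmbedding.eulerGenus {V : Type u} {G : SimpleGraph V}
    (E : SurfaceEmbedding G) : ℤ :=
  2 * (Nat.card G.ConnectedComponent : ℤ) -
    ((Nat.card V : ℤ) - (Nat.card G.edgeSet : ℤ) +
      ((Nat.card E.Face : ℤ) + (Nat.card {a : V // ∀ b : V, ¬ G.Adj a b} : ℤ)))

/-- The subgraph of `G` that consists of the vertices and edges on the boundary of a face. -/
def SurfaceEmbedding.boundary {V : Type u} {G : SimpleGraph V} (E : SurfaceEmbedding G)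
    (f : E.Face) : G.Subgraph where
  verts := {a : V | ∃ x, E.faceOf x = f ∧ x.1.fst = a}
  Adj a b := ∃ x, E.faceOf x = f ∧ x.1.fst = a ∧ x.1.snd = b
  adj_sub := by
    rintro a b ⟨x, -, rfl, rfl⟩
    exact x.1.adj
  edge_vert := by
    rintro a b ⟨x, hx, rfl, -⟩
    exact ⟨x, hx, rfl⟩
  symm := ⟨by
    rintro a b ⟨x, hx, rfl, rfl⟩
    have h : E.faceOf x = E.faceOf (flagOpp x) := Quot.sound (Or.inr rfl)
    exact ⟨flagOpp x, h.symm.trans hx, rfl, rfl⟩⟩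

/-- The face `f` is bounded by a cycle: its facial walk visits no vertex twice (the flags of `f` at
a vertex are those of a single corner) and traverses no edge twice. -/
def SurfaceEmbedding.IsBoundedByCycle {V : Type u} {G : SimpleGraph V} (E : SurfaceEmbedding G)
    (f : E.Face) : Prop :=
  (∀ x y, E.faceOf x = f → E.faceOf y = f → x.1.fst = y.1.fst → y = x ∨ y = E.turn x) ∧
  ∀ x, E.faceOf x = f → E.faceOf (flagSide x) ≠ f

/-! ### Almost embeddable graphs -/

/-- `B` is an `F`-vortex of width at most `k` for subgraphs `G₀` (the embedded graph, with facial
cycle `F`) and `H` of a common graph: an `F`-decomposition of `H`, with `V(G₀ ∩ H) = V(F)`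
and `x ∈ B x` for each vertex `x` of `F`. -/
structure Vortex {V : Type u} {G : SimpleGraph V} (G₀ F H : G.Subgraph) (k : ℕ) where
  decomp : Decomposition H.coe F.coe
  verts_inter : (G₀ ⊓ H).verts = F.verts
  mem_bag : ∀ x : F.verts, ∃ y ∈ decomp.bag x, (y : V) = (x : V)
  width_le : decomp.width ≤ k

/-- A representation of `G` as a `(g, p, k, a)`-almost-embeddable graph. -/
structure AlmostEmbedding {V : Type u} (G : SimpleGraph V) (g p k a : ℕ) where
  /-- the set of apex vertices -/
  apex : Set V
  apex_card : apex.encard ≤ a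
  /-- the number of vortices -/
  s : ℕ
  s_le : s ≤ p
  /-- the part of `G` embedded in the surface -/
  G₀ : G.Subgraph
  /-- the graphs `G_1, …, G_s` -/
  part : Fin s → G.Subgraph
  union_eq : (⊤ : G.Subgraph).deleteVerts apex = G₀ ⊔ ⨆ i, part i
  part_disjoint : ∀ i j, i ≠ j → Disjoint (part i).verts (part j).verts
  emb : SurfaceEmbedding G₀.coe
  genus_le : emb.eulerGenus ≤ g
  /-- the faces bounded by the facial cycles `F_1, …, F_s` -/
  face : Fin s → emb.Face
  face_cycle : ∀ i, emb.IsBoundedByCycle (face i)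
  face_disjoint : ∀ i j, i ≠ j →
    Disjoint (emb.boundary (face i)).verts (emb.boundary (face j)).verts
  vortex : ∀ i, Vortex G₀ (SimpleGraph.Subgraph.coeSubgraph (emb.boundary (face i))) (part i) k

/-- `G` is strongly `(g, p, k, a)`-almost-embeddable: moreover, no apex vertex is adjacent to a
vertex of `G₀ - (G_1 ∪ ⋯ ∪ G_s)`. -/
def IsStronglyAlmostEmbeddable {V : Type u} (G : SimpleGraph V) (g p k a : ℕ) : Prop :=
  ∃ E : AlmostEmbedding G g p k a, ∀ x ∈ E.apex, ∀ y ∈ E.G₀.verts,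
    (∀ i, y ∉ (E.part i).verts) → ¬ G.Adj x y

/-! ### Clique-sums -/

/-- `G` is a clique-sum of `G₁` and `G₂`: it is obtained from disjoint copies of them by identifying
a clique of `G₁` with a clique of the same size of `G₂`, and possibly deleting some edges of
this clique. The maps `f₁` and `f₂` place `G₁` and `G₂` in `G`. -/
def IsCliqueSum {V₁ : Type u} {V₂ : Type v} {V : Type w} (G₁ : SimpleGraph V₁)
    (G₂ : SimpleGraph V₂) (G : SimpleGraph V) : Prop :=
  ∃ (f₁ : V₁ ↪ V) (f₂ : V₂ ↪ V),
    Set.range f₁ ∪ Set.range f₂ = Set.univ ∧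
    G₁.IsClique (f₁ ⁻¹' Set.range f₂) ∧
    G₂.IsClique (f₂ ⁻¹' Set.range f₁) ∧
    G ≤ G₁.map f₁ ⊔ G₂.map f₂ ∧
    ∀ a b : V, (G₁.map f₁ ⊔ G₂.map f₂).Adj a b → ¬ G.Adj a b →
      a ∈ Set.range f₁ ∩ Set.range f₂ ∧ b ∈ Set.range f₁ ∩ Set.range f₂

/-- The graphs obtained by (repeated) clique-sums of graphs with property `P`. -/
inductive ObtainedByCliqueSums (P : ∀ V : Type u, SimpleGraph V → Prop) :
    ∀ V : Type u, SimpleGraph V → Prop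
  | base {V : Type u} (G : SimpleGraph V) (h : P V G) : ObtainedByCliqueSums P V G
  | sum {V₁ V₂ V : Type u} (G₁ : SimpleGraph V₁) (G₂ : SimpleGraph V₂) (G : SimpleGraph V)
      (h₁ : ObtainedByCliqueSums P V₁ G₁) (h₂ : ObtainedByCliqueSums P V₂ G₂)
      (h : IsCliqueSum G₁ G₂ G) : ObtainedByCliqueSums P V G

end LayeredSep

/-! Everything follows from goodness. A bag that balances `S` gives the separations; in a connected
graph of diameter `d` only `d + 1` consecutive layers can be non-empty, which bounds the bags.
Goodness survives clique-sums because it prescribes the first layer: the common clique occupies at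
most two consecutive layers of one summand, and the other summand can be layered starting from the
part in the earlier one. So it suffices to treat one strongly almost-embeddable graph and a clique
`K`.

There, layer 0 is `K`, and layer 1 contains all other apex and vortex vertices, all other neighbours
of `K`, and one vertex of each component of `G₀` that these sets miss; further layers are by
distance. A vertex of `G₀` outside the vortices has all its neighbours in `G₀`, so it can choose a
parent in an earlier layer. The result is a rooted forest in which vortex vertices are roots and a
path to the root meets each layer `i ≥ 1` at most once. If every bag of a tree decomposition of `G₀`
is a union of at most `2(g+p)+3` such paths, then replacing facial vertices by their vortex bags and
adding the apex set gives layered width at most `a + (2(g+p)+3)(k+1)`. Layer 0 costs at most `|K|`.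

This decomposition (`RootedEmbedding.exists_decomposition`) needs no triangulation. Its nodes are
the sides of the edges and the isolated vertices. Sides are linked around corners and across edges,
except at corners of special (vortex) faces, at one chosen corner of each other face, and across
forest edges. The bag of a side consists of the paths to the roots from the two ends of its edge and
from the chosen vertex of its face. For each `v`, the nodes whose bags contain `v` are connected by
links with an end below `v`: going around `v`, only one gap cannot be bridged (the edge to the
parent, or a special corner), and a cycle with one gap is connected. By Euler's formula at most
`g+s` links lie outside a suitable tree, where `s` bounds the number of special faces; the paths
from both ends of each of them are added to every bag. -/

namespace LayeredSep

universe u v w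

/-! ### Branches of trees, bags containing cliques, balanced separators -/

/-- `Branch T x y z`: the node `z` lies in the component of `T - x` that contains the
neighbour `y` of `x`. -/
def Branch {N : Type*} (T : SimpleGraph N) (x y z : N) : Prop :=
  T.Adj x y ∧ ∃ p : T.Walk y z, x ∉ p.support

theorem exists_branch {N : Type*} {T : SimpleGraph N} (hT : T.Connected) {x z : N} (h : x ≠ z) :
    ∃ y, Branch T x y z := by
  obtain ⟨p, hp⟩ := hT.exists_isPath x z
  cases p with
  | nil => exact absurd rfl h
  | cons hadj q =>
    rw [SimpleGraph.Walk.cons_isPath_iff] at hp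
    exact ⟨_, hadj, q, hp.2⟩

theorem Branch.step {N : Type*} {T : SimpleGraph N} {x y z z' : N} (h : Branch T x y z)
    (hz : T.Adj z z') (hx : z' ≠ x) : Branch T x y z' := by
  obtain ⟨hxy, p, hp⟩ := h
  refine ⟨hxy, p.concat hz, ?_⟩
  rw [SimpleGraph.Walk.support_concat]
  simp [hp, hx.symm]

theorem Branch.of_mem {N : Type*} {T : SimpleGraph N} {x y z z' : N} {S : Set N}
    (h : Branch T x y z) (hS : (T.induce S).Connected) (hx : x ∉ S) (hz : z ∈ S) (hz' : z' ∈ S) :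
    Branch T x y z' := by
  obtain ⟨p⟩ := hS.preconnected ⟨z, hz⟩ ⟨z', hz'⟩
  have key : ∀ (a b : S), (T.induce S).Walk a b → Branch T x y a → Branch T x y b := by
    intro a b p
    induction p with
    | nil => exact id
    | cons hadj q ih => exact fun ha => ih (ha.step hadj fun he => hx (he ▸ Subtype.coe_prop _))
  exact key _ _ p h

theorem Branch.unique {N : Type*} {T : SimpleGraph N} (hT : T.IsAcyclic) {x y y' z : N}
    (h : Branch T x y z) (h' : Branch T x y' z) : y = y' := by
  obtain ⟨hxy, p, hp⟩ := h
  obtain ⟨hxy', p', hp'⟩ := h'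
  have hb := SimpleGraph.isAcyclic_iff_forall_adj_isBridge.1 hT hxy
  rw [SimpleGraph.isBridge_iff_forall_walk_mem_edges] at hb
  have := hb (SimpleGraph.Walk.cons hxy' (p'.append p.reverse))
  rw [SimpleGraph.Walk.edges_cons, List.mem_cons] at this
  rcases this with h | h
  · rw [Sym2.eq_iff] at h
    rcases h with ⟨-, h⟩ | ⟨h, h2⟩
    · exact h
    · exact h2.trans h
  · have := SimpleGraph.Walk.fst_mem_support_of_mem_edges _ h
    rw [SimpleGraph.Walk.mem_support_append_iff] at this
    simp [hp, hp'] at this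

theorem Branch.not_symm {N : Type*} {T : SimpleGraph N} (hT : T.IsAcyclic) {x y z : N}
    (h : Branch T x y z) (h' : Branch T y x z) : False := by
  obtain ⟨hxy, p, hp⟩ := h
  obtain ⟨-, p', hp'⟩ := h'
  have hb := SimpleGraph.isAcyclic_iff_forall_adj_isBridge.1 hT hxy
  rw [SimpleGraph.isBridge_iff_forall_walk_mem_edges] at hb
  have := hb (p'.append p.reverse)
  rw [SimpleGraph.Walk.edges_append, List.mem_append] at this
  rcases this with h | h
  · exact hp' (SimpleGraph.Walk.snd_mem_support_of_mem_edges _ h)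
  · have := SimpleGraph.Walk.fst_mem_support_of_mem_edges _ h
    simp [hp] at this

/-- If every node points to a neighbour, some edge is pointed along in both directions; otherwise
the edges `s(x, t x)` would be distinct, and a tree has fewer edges than nodes. -/
theorem exists_adj_involutive {N : Type*} [Finite N] {T : SimpleGraph N} (hT : T.IsTree)
    (t : N → N) (ht : ∀ x, T.Adj x (t x)) : ∃ x, t (t x) = x := by
  by_contra! hne
  have hinj : Function.Injective (fun x => (⟨s(x, t x), ht x⟩ : T.edgeSet)) := by
    intro x x' h
    have h' : s(x, t x) = s(x', t x') := congrArg Subtype.val h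
    rw [Sym2.eq_iff] at h'
    rcases h' with ⟨h, -⟩ | ⟨h, h2⟩
    · exact h
    · exact absurd (by rw [h2, ← h]) (hne x)
  have h1 : Nat.card N ≤ Nat.card T.edgeSet := Nat.card_le_card_of_injective _ hinj
  have h2 := (SimpleGraph.isTree_iff_connected_and_card.1 hT).2
  omega

theorem Decomposition.exists_mem_bag {V N : Type*} {G : SimpleGraph V} {T : SimpleGraph N}
    (D : Decomposition G T) (a : V) : ∃ x, a ∈ D.bag x := by
  obtain ⟨x⟩ := (D.connected a).nonempty
  exact ⟨x.1, x.2⟩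

/-- Helly property of subtrees. If every bag misses a vertex `c x` of the clique, let `x` point to
the branch containing the bags of `c x`. On an edge pointed along both ways, the two missed vertices
share a bag, which would lie on both sides of the edge. -/
theorem Decomposition.exists_subset_bag {V N : Type*} [Finite N] {G : SimpleGraph V}
    {T : SimpleGraph N} (hT : T.IsTree) (D : Decomposition G T) {K : Set V} (hK : G.IsClique K) :
    ∃ x, K ⊆ D.bag x := by
  by_contra! hne
  simp only [Set.not_subset] at hne
  choose c hcK hc using hne
  choose z hz using D.exists_mem_bag
  have hxz : ∀ x, x ≠ z (c x) := fun x h => hc x (by have := hz (c x); rwa [← h] at this)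
  choose t ht using fun x => exists_branch hT.connected (hxz x)
  obtain ⟨x, hx⟩ := exists_adj_involutive hT t fun x => (ht x).1
  obtain ⟨w, h1, h2⟩ : ∃ w, c x ∈ D.bag w ∧ c (t x) ∈ D.bag w := by
    by_cases he : c x = c (t x)
    · exact ⟨z (c x), hz _, he ▸ hz _⟩
    · exact D.edge_mem _ _ (hK (hcK _) (hcK _) he)
  have b1 := (ht x).of_mem (D.connected (c x)) (hc x) (hz _) h1
  have b2 := (ht (t x)).of_mem (D.connected (c (t x))) (hc (t x)) (hz _) h2
  rw [hx] at b2
  exact b1.not_symm hT.isAcyclic b2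

/-- Every set of vertices has a bag of a given tree decomposition as a balanced separator. -/
theorem Decomposition.exists_balanced_bag {V N : Type*} [Finite V] [Finite N] {G : SimpleGraph V}
    {T : SimpleGraph N} (hT : T.IsTree) (D : Decomposition G T) (S : Set V) :
    ∃ x, ∀ y, 2 * {a ∈ S | a ∉ D.bag x ∧ ∃ z, a ∈ D.bag z ∧ Branch T x y z}.ncard ≤ S.ncard := by
  by_contra! hne
  choose t ht using hne
  have hadj : ∀ x, T.Adj x (t x) := by
    intro x
    have : {a ∈ S | a ∉ D.bag x ∧ ∃ z, a ∈ D.bag z ∧ Branch T x (t x) z}.Nonempty := by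
      rw [← Set.ncard_pos]
      have := ht x
      omega
    obtain ⟨a, -, -, z, -, hz⟩ := this
    exact hz.1
  -- Each node points to a branch with more than half of `S`; on an edge pointed along both ways,
  -- two disjoint sets would each have more than half.
  obtain ⟨x, hx⟩ := exists_adj_involutive hT t hadj
  have h1 := ht x
  have h2 := ht (t x)
  rw [hx] at h2
  have hd : Disjoint {a ∈ S | a ∉ D.bag x ∧ ∃ z, a ∈ D.bag z ∧ Branch T x (t x) z}
      {a ∈ S | a ∉ D.bag (t x) ∧ ∃ z, a ∈ D.bag z ∧ Branch T (t x) x z} := by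
    rw [Set.disjoint_left]
    rintro a ⟨-, ha, z, hz, hb⟩ ⟨-, ha', z', hz', hb'⟩
    exact (hb.of_mem (D.connected a) ha hz hz').not_symm hT.isAcyclic hb'
  have h3 := Set.ncard_union_eq hd
  have h4 : ({a ∈ S | a ∉ D.bag x ∧ ∃ z, a ∈ D.bag z ∧ Branch T x (t x) z} ∪
      {a ∈ S | a ∉ D.bag (t x) ∧ ∃ z, a ∈ D.bag z ∧ Branch T (t x) x z}).ncard ≤ S.ncard :=
    Set.ncard_le_ncard (by rintro a (h | h) <;> exact h.1)
  omega

/-- Classes each containing at most half of the elements can be split into two groups, each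
containing at most two thirds of the elements. -/
theorem exists_balanced_split {α ι : Type*} [Finite ι] [Finite α] (S : Set α) (f : α → ι) (n : ℕ)
    (hS : S.ncard ≤ n) (h : ∀ i, 2 * {a ∈ S | f a = i}.ncard ≤ n) :
    ∃ Z : Set ι, 3 * {a ∈ S | f a ∈ Z}.ncard ≤ 2 * n ∧ 3 * {a ∈ S | f a ∉ Z}.ncard ≤ 2 * n := by
  by_cases h0 : 3 * S.ncard ≤ 2 * n
  · refine ⟨Set.univ, ?_, ?_⟩ <;> simp [h0]
  -- Take a minimal group with at least a third. If it had more than two thirds, each non-empty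
  -- class in it would have more than a third, so by minimality it would be a single class, which
  -- has at most half.
  obtain ⟨Z, hZ⟩ := (Set.toFinite {Z : Set ι | n ≤ 3 * {a ∈ S | f a ∈ Z}.ncard}).exists_minimal
    ⟨Set.univ, by simp; omega⟩
  have hZn : n ≤ 3 * {a ∈ S | f a ∈ Z}.ncard := hZ.prop
  have hsum : {a ∈ S | f a ∈ Z}.ncard + {a ∈ S | f a ∉ Z}.ncard = S.ncard := by
    rw [← Set.ncard_union_eq (by rw [Set.disjoint_left]; rintro a ⟨-, h⟩ ⟨-, h'⟩; exact h' h)]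
    congr 1
    ext a
    simp only [Set.mem_union, Set.mem_ofPred_eq]
    tauto
  refine ⟨Z, ?_, by omega⟩
  obtain ⟨a, -, ha⟩ : {a ∈ S | f a ∈ Z}.Nonempty := by
    rw [← Set.ncard_pos]
    omega
  have hspl : {a ∈ S | f a ∈ Z}.ncard ≤
      {b ∈ S | f b ∈ Z \ {f a}}.ncard + {b ∈ S | f b = f a}.ncard := by
    refine (Set.ncard_le_ncard fun b hb => ?_).trans (Set.ncard_union_le _ _)
    by_cases hab : f b = f a
    · exact Or.inr ⟨hb.1, hab⟩
    · exact Or.inl ⟨hb.1, hb.2, hab⟩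
  have hlt : 3 * {b ∈ S | f b ∈ Z \ {f a}}.ncard < n := by
    by_contra! hle
    exact (hZ.le_of_le hle Set.sdiff_subset ha).2 rfl
  by_contra! hgt
  have hia := h (f a)
  have hone : Z ⊆ {f a} := by
    refine hZ.le_of_le (y := {f a}) ?_ (by simpa using ha)
    simp only [Set.mem_ofPred_eq, Set.mem_singleton_iff]
    omega
  have : {a ∈ S | f a ∈ Z}.ncard ≤ {b ∈ S | f b = f a}.ncard :=
    Set.ncard_le_ncard fun b hb => ⟨hb.1, hone hb.2⟩
  omega

/-! ### Building trees and counting edges outside them -/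

/-- Joining two trees by an edge yields a tree. -/
theorem isTree_sum_sup_edge {N₁ N₂ : Type*} [Finite N₁] [Finite N₂] {T₁ : SimpleGraph N₁}
    {T₂ : SimpleGraph N₂} (h₁ : T₁.IsTree) (h₂ : T₂.IsTree) (x₁ : N₁) (x₂ : N₂) :
    ((T₁ ⊕g T₂) ⊔ SimpleGraph.edge (Sum.inl x₁) (Sum.inr x₂)).IsTree := by
  rw [SimpleGraph.isTree_iff_connected_and_card] at h₁ h₂ ⊢
  refine ⟨h₁.1.sum_sup_edge h₂.1, ?_⟩
  have he : (SimpleGraph.edge (Sum.inl x₁ : N₁ ⊕ N₂) (Sum.inr x₂)).edgeSet =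
      {s(Sum.inl x₁, Sum.inr x₂)} := by
    rw [SimpleGraph.edgeSet_edge, sdiff_eq_left]
    simp
  rw [SimpleGraph.edgeSet_sup, he, Nat.card_coe_set_eq, Set.union_singleton,
    Set.ncard_insert_of_notMem (by simp) (Set.toFinite _), ← Nat.card_coe_set_eq,
    Nat.card_congr SimpleGraph.edgeSetSumEquiv, Nat.card_sum, Nat.card_sum]
  omega

/-- A new vertex joined to one representative of each component makes the graph connected, and a
connected graph has at least as many edges as vertices minus one. -/
theorem card_le_card_edgeSet_add_card_component {N : Type*} [Finite N] (F : SimpleGraph N) :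
    Nat.card N ≤ Nat.card F.edgeSet + Nat.card F.ConnectedComponent := by
  let R : Set N := Set.range fun c : F.ConnectedComponent => c.out
  let F' : SimpleGraph (Option N) :=
    F.map Function.Embedding.some ⊔ SimpleGraph.fromEdgeSet ((fun a => s(none, some a)) '' R)
  have hout : ∀ a : N, F'.Reachable none (some a) := by
    intro a
    have h1 : F'.Adj none (some (F.connectedComponentMk a).out) := by
      refine Or.inr ?_
      rw [SimpleGraph.fromEdgeSet_adj]
      exact ⟨⟨_, ⟨_, rfl⟩, rfl⟩, by simp⟩
    have h2 : F.Reachable (F.connectedComponentMk a).out a :=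
      SimpleGraph.ConnectedComponent.exact (Quot.out_eq _)
    refine h1.reachable.trans ((h2.map (SimpleGraph.Embedding.map Function.Embedding.some F).toHom).mono
      le_sup_left)
  have hc : F'.Connected := by
    rw [SimpleGraph.connected_iff_exists_forall_reachable]
    refine ⟨none, fun w => ?_⟩
    cases w with
    | none => rfl
    | some a => exact hout a
  have h := hc.card_vert_le_card_edgeSet_add_one
  rw [Finite.card_option] at h
  have h2 : Nat.card F'.edgeSet ≤ Nat.card F.edgeSet + Nat.card F.ConnectedComponent := by
    have hs : F'.edgeSet ⊆ Sym2.map some '' F.edgeSet ∪ (fun a => s(none, some a)) '' R := by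
      rw [SimpleGraph.edgeSet_sup, SimpleGraph.edgeSet_map]
      refine Set.union_subset_union (by rfl) ?_
      rw [SimpleGraph.edgeSet_fromEdgeSet]
      exact Set.sdiff_subset
    rw [Nat.card_coe_set_eq, Nat.card_coe_set_eq]
    refine (Set.ncard_le_ncard hs).trans ((Set.ncard_union_le _ _).trans ?_)
    refine add_le_add (Set.ncard_image_le (Set.toFinite _)) ((Set.ncard_image_le (Set.toFinite _)).trans ?_)
    change (Set.range _).ncard ≤ _
    rw [← Set.image_univ]
    exact (Set.ncard_image_le (Set.toFinite _)).trans (Set.ncard_univ _).le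
  omega

/-- A multigraph with edges `J` on the vertices `N` whose connected components are indexed by `C`
contains all but `|J| - |N| + |C|` of its edges in some tree. -/
theorem exists_isTree_of_links {N J C : Type*} [Finite N] [Nonempty N] [Finite J] [Finite C]
    (link : J → N × N) (comp : N → C)
    (hcomp : ∀ a b, comp a = comp b → Relation.EqvGen (fun x y => ∃ j, link j = (x, y)) a b) :
    ∃ (T : SimpleGraph N) (X : Set J), T.IsTree ∧ (∀ j ∉ X, T.Adj (link j).1 (link j).2) ∧
      X.ncard + Nat.card N ≤ Nat.card J + Nat.card C := by
  let D : SimpleGraph N := SimpleGraph.fromRel fun x y => ∃ j, link j = (x, y)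
  obtain ⟨F, hFD, hF, hr⟩ := SimpleGraph.exists_isAcyclic_reachable_eq_le (G := D)
  -- The edges of `T` outside the spanning forest `F` are arbitrary; they only join different
  -- components. Of parallel links, one representative is kept.
  obtain ⟨T, hFT, -, hT⟩ := SimpleGraph.Connected.exists_isTree_le_of_le_of_isAcyclic
    (SimpleGraph.connected_top (V := N)) (le_top : F ≤ ⊤) hF
  have hrep : ∀ e : F.edgeSet, ∃ j, s((link j).1, (link j).2) = e.1 := by
    rintro ⟨e, he⟩
    induction e with
    | h a b =>
      have := hFD he
      rw [SimpleGraph.fromRel_adj] at this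
      obtain ⟨-, ⟨j, hj⟩ | ⟨j, hj⟩⟩ := this
      · exact ⟨j, by simp [hj]⟩
      · exact ⟨j, by simp [hj, Sym2.eq_swap]⟩
  choose r hr' using hrep
  refine ⟨T, (Set.range r)ᶜ, hT, ?_, ?_⟩
  · intro j hj
    rw [Set.notMem_compl_iff] at hj
    obtain ⟨e, rfl⟩ := hj
    apply hFT
    rw [← SimpleGraph.mem_edgeSet, hr']
    exact e.2
  have hinj : Function.Injective r := fun e e' h => Subtype.ext (by rw [← hr', ← hr', h])
  have h1 : (Set.range r).ncard = Nat.card F.edgeSet := by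
    rw [← Nat.card_coe_set_eq]
    exact Nat.card_range_of_injective hinj
  have h2 := Set.ncard_add_ncard_compl (Set.range r)
  have h3 := card_le_card_edgeSet_add_card_component F
  have h4 : Nat.card F.ConnectedComponent ≤ Nat.card C := by
    refine Nat.card_le_card_of_injective (fun c => comp c.out) fun c c' h => ?_
    have key : ∀ a b, Relation.EqvGen (fun x y => ∃ j, link j = (x, y)) a b → D.Reachable a b := by
      intro a b h
      induction h with
      | rel a b h =>
        by_cases hab : a = b
        · rw [hab]
        · exact SimpleGraph.Adj.reachable ((SimpleGraph.fromRel_adj _ _ _).2 ⟨hab, Or.inl h⟩)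
      | refl => rfl
      | symm _ _ _ ih => exact ih.symm
      | trans _ _ _ _ _ ih1 ih2 => exact ih1.trans ih2
    have := key _ _ (hcomp _ _ h)
    rw [← hr] at this
    rw [← Quot.out_eq c, ← Quot.out_eq c']
    exact SimpleGraph.ConnectedComponent.sound this
  omega

/-- Decompositions over a finite tree can be reindexed by `Fin n`. -/
theorem Decomposition.exists_fin {V N : Type*} [Finite N] {G : SimpleGraph V} {T : SimpleGraph N}
    (hT : T.IsTree) (D : Decomposition G T) :
    ∃ (n : ℕ) (T' : SimpleGraph (Fin n)) (D' : Decomposition G T'), T'.IsTree ∧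
      ∀ x, ∃ y, D'.bag x = D.bag y := by
  obtain ⟨n, ⟨e⟩⟩ := Finite.exists_equiv_fin N
  let T' : SimpleGraph (Fin n) := T.comap e.symm
  have i : T' ≃g T := SimpleGraph.Iso.comap e.symm T
  refine ⟨n, T', ⟨fun x => D.bag (e.symm x), ?_, ?_⟩, ?_, fun x => ⟨_, rfl⟩⟩
  · intro a b h
    obtain ⟨x, hx⟩ := D.edge_mem a b h
    exact ⟨e x, by simpa using hx⟩
  · intro a
    let f : T.induce {x | a ∈ D.bag x} →g T'.induce {x | a ∈ D.bag (e.symm x)} :=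
      ⟨fun x => ⟨e x.1, (congrArg (a ∈ D.bag ·) (e.symm_apply_apply x.1)).mpr x.2⟩, fun {x y} h => by simpa [T'] using h⟩
    refine (D.connected a).map f fun x => ⟨⟨e.symm x.1, x.2⟩, Subtype.ext (e.apply_symm_apply x.1)⟩
  · exact i.isTree_iff.2 hT

/-! ### Cycles formed by two involutions -/

theorem even_ncard_of_involution {α : Type*} [Finite α] (a : α → α) (ha : ∀ x, a (a x) = x)
    (hn : ∀ x, a x ≠ x) (S : Set α) (hS : ∀ x ∈ S, a x ∈ S) : Even S.ncard := by
  classical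
  have := Fintype.ofFinite α
  have h : ∑ x ∈ S.toFinset, (1 : ZMod 2) = 0 :=
    Finset.sum_involution (fun x _ => a x) (fun _ _ => by decide) (fun x _ _ => hn x)
      (fun x hx => by simpa using hS x (by simpa using hx)) (fun x _ => ha x)
  rw [Finset.sum_const, nsmul_one, ZMod.natCast_eq_zero_iff_even] at h
  rwa [Set.ncard_eq_toFinset_card']

/-- A cycle consisting of the pairs of two involutions stays connected when one pair is removed. -/
theorem rel_of_orbit {α : Type*} [Finite α] (a b : α → α) (ha : ∀ x, a (a x) = x)
    (hb : ∀ x, b (b x) = x) (ha' : ∀ x, a x ≠ x) (hb' : ∀ x, b x ≠ x) (Z : Set α)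
    (hZa : ∀ x ∈ Z, a x ∈ Z) (hZb : ∀ x ∈ Z, b x ∈ Z)
    (hZ : ∀ x ∈ Z, ∀ y ∈ Z, Relation.EqvGen (fun x y => y = a x ∨ y = b x) x y)
    (R : α → α → Prop) (hR : Equivalence R) (hRb : ∀ x ∈ Z, R x (b x)) (x₀ : α)
    (hRa : ∀ x ∈ Z, x ≠ x₀ → a x ≠ x₀ → R x (a x)) : ∀ x ∈ Z, ∀ y ∈ Z, R x y := by
  -- Parity: if `a x₀` were not in the class of `x₀`, this class would be closed under `b`, and
  -- closed under `a` after removing `x₀`, so both cardinalities would be even.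
  have h0 : x₀ ∈ Z → R x₀ (a x₀) := by
    intro hx₀
    by_contra hne
    have h1 : Even {y | y ∈ Z ∧ R x₀ y}.ncard := by
      refine even_ncard_of_involution b hb hb' _ ?_
      rintro y ⟨hy, hRy⟩
      exact ⟨hZb y hy, hR.trans hRy (hRb y hy)⟩
    have h2 : Even ({y | y ∈ Z ∧ R x₀ y} \ {x₀}).ncard := by
      refine even_ncard_of_involution a ha ha' _ ?_
      rintro y ⟨⟨hy, hRy⟩, hyx⟩
      have hay : a y ≠ x₀ := by
        rintro rfl
        rw [ha] at hne
        exact hne hRy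
      exact ⟨⟨hZa y hy, hR.trans hRy (hRa y hy hyx hay)⟩, hay⟩
    have h3 := Set.ncard_sdiff_singleton_add_one (s := {y | y ∈ Z ∧ R x₀ y})
      (a := x₀) ⟨hx₀, hR.refl _⟩ (Set.toFinite _)
    rw [← h3] at h1
    exact (Nat.not_even_iff_odd.2 h2.add_one) h1
  have hRa' : ∀ x ∈ Z, R x (a x) := by
    intro x hx
    by_cases h : x = x₀
    · subst h
      exact h0 hx
    by_cases h' : a x = x₀
    · subst h'
      have := hR.symm (h0 (hZa x hx))
      rwa [ha] at this
    · exact hRa x hx h h'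
  intro x hx y hy
  have key : ∀ x y, Relation.EqvGen (fun x y => y = a x ∨ y = b x) x y →
      (x ∈ Z ↔ y ∈ Z) ∧ (x ∈ Z → R x y) := by
    intro x y h
    induction h with
    | rel x y h =>
      rcases h with rfl | rfl
      · exact ⟨⟨hZa x, fun h => ha x ▸ hZa _ h⟩, hRa' x⟩
      · exact ⟨⟨hZb x, fun h => hb x ▸ hZb _ h⟩, hRb x⟩
    | refl x => exact ⟨Iff.rfl, fun _ => hR.refl x⟩
    | symm x y _ ih => exact ⟨ih.1.symm, fun h => hR.symm (ih.2 (ih.1.2 h))⟩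
    | trans x y z _ _ ih1 ih2 =>
      exact ⟨ih1.1.trans ih2.1, fun h => hR.trans (ih1.2 h) (ih2.2 (ih1.1.1 h))⟩
  exact (key x y (hZ x hx y hy)).2 hx

/-! ### Rooted embeddings: links between the sides of edges -/

instance finite_dart {U : Type*} [Finite U] (H : SimpleGraph U) : Finite H.Dart :=
  Finite.of_injective (fun d => d.toProd) fun _ _ h => SimpleGraph.Dart.ext _ _ h

/-- An embedded graph with a set of special faces and a spanning forest, given by the parents of the
vertices, in which every vertex of a special face is a root. -/
structure RootedEmbedding {U : Type u} (H : SimpleGraph U) where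
  emb : SurfaceEmbedding H
  special : Set emb.Face
  special_flag : ∀ x y, emb.faceOf x ∈ special → emb.faceOf y ∈ special → x.1.fst = y.1.fst →
    y = x ∨ y = emb.turn x
  parent : U → Option U
  rank : U → ℕ
  parent_adj : ∀ a b, parent a = some b → H.Adj a b
  parent_rank : ∀ a b, parent a = some b → rank b < rank a
  parent_special : ∀ x, emb.faceOf x ∈ special → parent x.1.fst = none

namespace RootedEmbedding

variable {U : Type u} {H : SimpleGraph U} (R : RootedEmbedding H)

/-- `R.Anc a b`: the vertex `b` is on the path from `a` to the root. -/
def Anc (a b : U) : Prop := Relation.ReflTransGen (fun a b => R.parent a = some b) a b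

/-- A chosen flag of a face. -/
noncomputable def flag (f : R.emb.Face) : H.Dart × Bool := Quot.out f

theorem faceOf_flag (f : R.emb.Face) : R.emb.faceOf (R.flag f) = f := Quot.out_eq f

/-- A corner is marked if its face is special or if it is the chosen corner of its face. -/
def Marked (x : H.Dart × Bool) : Prop :=
  R.emb.faceOf x ∈ R.special ∨ x = R.flag (R.emb.faceOf x) ∨
    R.emb.turn x = R.flag (R.emb.faceOf x)

theorem faceOf_turn (x : H.Dart × Bool) : R.emb.faceOf (R.emb.turn x) = R.emb.faceOf x := by
  refine Eq.symm (Quot.sound ?_)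
  exact Or.inl rfl

theorem faceOf_flagOpp (x : H.Dart × Bool) : R.emb.faceOf (flagOpp x) = R.emb.faceOf x := by
  refine Eq.symm (Quot.sound ?_)
  exact Or.inr rfl

theorem marked_turn (x : H.Dart × Bool) : R.Marked (R.emb.turn x) ↔ R.Marked x := by
  unfold Marked
  rw [R.faceOf_turn, R.emb.turn_turn]
  tauto

/-- Corners, as pairs of flags. -/
def cornerSetoid : Setoid (H.Dart × Bool) where
  r x y := y = x ∨ y = R.emb.turn x
  iseqv := by
    refine ⟨fun x => Or.inl rfl, ?_, ?_⟩
    · rintro x y (rfl | rfl)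
      · exact Or.inl rfl
      · exact Or.inr (R.emb.turn_turn x).symm
    · rintro x y z (rfl | rfl) (rfl | rfl)
      · exact Or.inl rfl
      · exact Or.inr rfl
      · exact Or.inr rfl
      · exact Or.inl (R.emb.turn_turn x)

abbrev Corner : Type u := Quotient R.cornerSetoid

/-- The edges of the forest. -/
def IsForestEdge (e : H.edgeSet) : Prop := ∃ a b, R.parent a = some b ∧ e.1 = s(a, b)

/-- The nodes are the sides of the edges and the isolated vertices. -/
abbrev Node (H : SimpleGraph U) : Type u := (H.edgeSet × Bool) ⊕ {a : U // ∀ b : U, ¬ H.Adj a b}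

def side (x : H.Dart × Bool) : Node H := Sum.inl (⟨x.1.edge, x.1.edge_mem⟩, x.2)

theorem side_flagOpp (x : H.Dart × Bool) : side (flagOpp x) = side x := by
  simp [side, flagOpp, SimpleGraph.Dart.edge_symm]

/-- Two sides are linked at unmarked corners and across edges that are not in the forest. -/
abbrev Link : Type u := {c : R.Corner // ¬ R.Marked c.out} ⊕ {e : H.edgeSet // ¬ R.IsForestEdge e}

noncomputable def link : R.Link → Node H × Node H
  | Sum.inl c => (side c.1.out, side (R.emb.turn c.1.out))
  | Sum.inr e => (Sum.inl (e.1, false), Sum.inl (e.1, true))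

/-- Chosen so that both ends of a link lie in `base` of both linked nodes; for a corner these are
its vertex and the chosen vertex of its face. -/
noncomputable def ends : R.Link → U × U
  | Sum.inl c => (c.1.out.1.fst, (R.flag (R.emb.faceOf c.1.out)).1.fst)
  | Sum.inr e => Quot.out e.1.1

/-- Nodes connected by links that have an end below `v`. -/
def Conn (v : U) : Node H → Node H → Prop :=
  Relation.EqvGen fun p q => ∃ j, (R.Anc (R.ends j).1 v ∨ R.Anc (R.ends j).2 v) ∧ R.link j = (p, q)

theorem Conn.equivalence (v : U) : Equivalence (R.Conn v) := Relation.EqvGen.is_equivalence _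

variable {R}

theorem Conn.mono {a b : U} {p q : Node H} (hab : R.Anc a b) (h : R.Conn a p q) :
    R.Conn b p q := by
  refine Relation.EqvGen.mono ?_ _ _ h
  rintro p q ⟨j, hj, hpq⟩
  exact ⟨j, hj.imp (fun h => Relation.ReflTransGen.trans h hab)
    fun h => Relation.ReflTransGen.trans h hab, hpq⟩

theorem conn_turn {v : U} {x : H.Dart × Bool} (hx : ¬ R.Marked x)
    (h : R.Anc x.1.fst v ∨ R.Anc (R.flag (R.emb.faceOf x)).1.fst v) :
    R.Conn v (side x) (side (R.emb.turn x)) := by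
  have hout : x = (Quotient.mk R.cornerSetoid x).out ∨
      x = R.emb.turn (Quotient.mk R.cornerSetoid x).out := Quotient.mk_out (s := R.cornerSetoid) x
  generalize hc : Quotient.mk R.cornerSetoid x = c at hout
  rcases hout with hout | hout
  · subst hout
    exact Relation.EqvGen.rel _ _ ⟨Sum.inl ⟨c, hx⟩, h, rfl⟩
  · rw [hout, R.faceOf_turn, R.emb.turn_fst] at h
    rw [hout, R.marked_turn] at hx
    rw [hout, R.emb.turn_turn]
    exact Relation.EqvGen.symm _ _ (Relation.EqvGen.rel _ _ ⟨Sum.inl ⟨c, hx⟩, h, rfl⟩)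

theorem conn_flagSide {v : U} {x : H.Dart × Bool} (hx : ¬ R.IsForestEdge ⟨x.1.edge, x.1.edge_mem⟩)
    (h : R.Anc x.1.fst v) : R.Conn v (side x) (side (flagSide x)) := by
  have hlink : R.Conn v (Sum.inl (⟨x.1.edge, x.1.edge_mem⟩, false))
      (Sum.inl (⟨x.1.edge, x.1.edge_mem⟩, true)) := by
    refine Relation.EqvGen.rel _ _ ⟨Sum.inr ⟨⟨x.1.edge, x.1.edge_mem⟩, hx⟩, ?_, rfl⟩
    have ho : s((Quot.out x.1.edge).1, (Quot.out x.1.edge).2) = s(x.1.fst, x.1.snd) :=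
      Quot.out_eq x.1.edge
    rw [Sym2.eq_iff] at ho
    change R.Anc (Quot.out x.1.edge).1 v ∨ R.Anc (Quot.out x.1.edge).2 v
    rcases ho with ho | ho
    · exact Or.inl (ho.1 ▸ h)
    · exact Or.inr (ho.2 ▸ h)
  obtain ⟨d, b⟩ := x
  cases b
  · exact hlink
  · exact Relation.EqvGen.symm _ _ hlink

/-- The facial walk of a non-special face has a link at every corner but the chosen one, and the
chosen vertex is an end of each of these links. One gap does not disconnect the walk. -/
theorem conn_of_faceOf_eq [Finite U] {v : U} {f : R.emb.Face} (hf : f ∉ R.special)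
    (hv : R.Anc (R.flag f).1.fst v) {x y : H.Dart × Bool} (hx : R.emb.faceOf x = f)
    (hy : R.emb.faceOf y = f) : R.Conn v (side x) (side y) := by
  have hE := Conn.equivalence R v
  refine rel_of_orbit R.emb.turn flagOpp R.emb.turn_turn (fun x => by simp [flagOpp])
    R.emb.turn_ne (fun x h => x.1.symm_ne (congrArg Prod.fst h)) {z | R.emb.faceOf z = f}
    (fun z hz => (R.faceOf_turn z).trans hz) (fun z hz => (R.faceOf_flagOpp z).trans hz) ?_
    (fun x y => R.Conn v (side x) (side y)) ⟨fun _ => hE.refl _, hE.symm, hE.trans⟩ ?_ (R.flag f) ?_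
    x hx y hy
  · intro x hx y hy
    exact Quot.eqvGen_exact (Eq.trans hx (Eq.symm hy))
  · intro x _
    rw [side_flagOpp]
    exact hE.refl _
  · intro x hx h1 h2
    rw [Set.mem_ofPred_eq] at hx
    refine conn_turn ?_ (Or.inr (by rwa [hx]))
    rintro (h | h | h)
    · exact hf (hx ▸ h)
    · exact h1 (hx ▸ h)
    · exact h2 (hx ▸ h)

/-- Going around `v`, an unmarked corner or a non-forest edge is a link with end `v`, a chosen
corner at `v` is bypassed around its face, and an edge to a child is bypassed around the child, by
induction. One gap remains at most: a special corner if `v` is on a special face (then `v` has no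
parent), or else the edge to the parent. -/
theorem conn_of_fst_eq [Finite U] (v : U) {x y : H.Dart × Bool} (hx : x.1.fst = v)
    (hy : y.1.fst = v) : R.Conn v (side x) (side y) := by
  obtain ⟨B, hB⟩ : ∃ B, ∀ a, R.rank a ≤ B := by
    obtain ⟨B, hB⟩ := (Set.finite_range R.rank).bddAbove
    exact ⟨B, fun a => hB ⟨a, rfl⟩⟩
  -- Children have larger rank, so the induction goes down from the bound `B`.
  induction hn : B - R.rank v using Nat.strong_induction_on generalizing v x y with
  | _ n ih =>
  have hE := Conn.equivalence R v
  have hE' : Equivalence fun x y : H.Dart × Bool => R.Conn v (side x) (side y) :=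
    ⟨fun _ => hE.refl _, hE.symm, hE.trans⟩
  have hturn : ∀ z : H.Dart × Bool, z.1.fst = v → R.emb.faceOf z ∉ R.special →
      R.Conn v (side z) (side (R.emb.turn z)) := by
    intro z hz hsp
    by_cases hm : R.Marked z
    · refine conn_of_faceOf_eq hsp ?_ rfl (R.faceOf_turn z)
      rcases hm with h | h | h
      · exact absurd h hsp
      · rw [← h, hz]
        exact Relation.ReflTransGen.refl
      · rw [← h, R.emb.turn_fst, hz]
        exact Relation.ReflTransGen.refl
    · exact conn_turn hm (Or.inl (hz ▸ Relation.ReflTransGen.refl))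
  have hside : ∀ z : H.Dart × Bool, z.1.fst = v → R.parent v ≠ some z.1.snd →
      R.Conn v (side z) (side (flagSide z)) := by
    intro z hz hp
    by_cases hf : R.IsForestEdge ⟨z.1.edge, z.1.edge_mem⟩
    · obtain ⟨a, b, hab, he⟩ := hf
      have he' : s(z.1.fst, z.1.snd) = s(a, b) := he
      rw [Sym2.eq_iff] at he'
      rcases he' with ⟨h1, h2⟩ | ⟨h1, h2⟩
      · rw [← h1, ← h2, hz] at hab
        exact absurd hab hp
      · rw [← h1, ← h2, hz] at hab
        have hr := R.parent_rank _ _ hab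
        have hB' := hB z.1.snd
        have := ih (B - R.rank z.1.snd) (by omega) z.1.snd (x := flagOpp z)
          (y := flagOpp (flagSide z)) rfl rfl rfl
        rw [side_flagOpp, side_flagOpp] at this
        exact this.mono (Relation.ReflTransGen.single hab)
    · exact conn_flagSide hf (hz ▸ Relation.ReflTransGen.refl)
  have hss : ∀ z : H.Dart × Bool, flagSide (flagSide z) = z := fun z => by simp [flagSide]
  have hsn : ∀ z : H.Dart × Bool, flagSide z ≠ z := fun z h => by
    have := congrArg Prod.snd h
    simp [flagSide] at this
  by_cases hsp : ∃ x₀ : H.Dart × Bool, x₀.1.fst = v ∧ R.emb.faceOf x₀ ∈ R.special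
  · obtain ⟨x₀, hx₀, hsp⟩ := hsp
    refine rel_of_orbit R.emb.turn flagSide R.emb.turn_turn hss R.emb.turn_ne hsn
      {z | z.1.fst = v} (fun z hz => (R.emb.turn_fst z).trans hz) (fun z hz => hz)
      (fun z hz z' hz' => R.emb.rotation z z' (Eq.trans hz (Eq.symm hz'))) _ hE' ?_ x₀ ?_ x hx y hy
    · intro z hz
      refine hside z hz ?_
      rw [← hx₀, R.parent_special x₀ hsp]
      simp
    · intro z hz h1 h2
      refine hturn z hz fun hzs => ?_
      rcases R.special_flag z x₀ hzs hsp (Eq.trans hz hx₀.symm) with h | h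
      · exact h1 h.symm
      · exact h2 h.symm
  · push Not at hsp
    have hrot : ∀ z ∈ {z : H.Dart × Bool | z.1.fst = v}, ∀ z' ∈ {z : H.Dart × Bool | z.1.fst = v},
        Relation.EqvGen (fun x y => y = flagSide x ∨ y = R.emb.turn x) z z' :=
      fun z hz z' hz' => Relation.EqvGen.mono (fun _ _ h => Or.symm h) _ _
        (R.emb.rotation z z' (Eq.trans hz (Eq.symm hz')))
    -- Here `x₀` is a flag of the edge to the parent; for a root the condition on it is vacuous.
    have main : ∀ x₀ : H.Dart × Bool,
        (∀ z : H.Dart × Bool, z.1.fst = v → R.parent v = some z.1.snd → z = x₀ ∨ flagSide z = x₀) →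
        R.Conn v (side x) (side y) := by
      intro x₀ h₀
      refine rel_of_orbit flagSide R.emb.turn hss R.emb.turn_turn hsn R.emb.turn_ne
        {z | z.1.fst = v} (fun z hz => hz) (fun z hz => (R.emb.turn_fst z).trans hz)
        hrot _ hE' (fun z hz => hturn z hz (hsp z hz)) x₀ ?_ x hx y hy
      intro z hz h1 h2
      exact hside z hz fun h => (h₀ z hz h).elim h1 h2
    cases hpar : R.parent v with
    | none => exact main x fun z _ h => by simp [hpar] at h
    | some w =>
      refine main (⟨(v, w), R.parent_adj _ _ hpar⟩, true) fun z hz h => ?_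
      obtain ⟨⟨⟨a, b⟩, hab⟩, t⟩ := z
      simp only at hz
      subst hz
      simp only [hpar, Option.some.injEq] at h
      subst h
      cases t
      · exact Or.inr rfl
      · exact Or.inl rfl

end RootedEmbedding

/-! ### The bags and their connectedness -/

namespace RootedEmbedding

variable {U : Type u} {H : SimpleGraph U} {R : RootedEmbedding H}

theorem exists_side_eq (p : H.edgeSet × Bool) : ∃ x : H.Dart × Bool, side x = Sum.inl p := by
  obtain ⟨⟨e, he⟩, b⟩ := p
  induction e with
  | h a c => exact ⟨(⟨(a, c), he⟩, b), rfl⟩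

theorem eq_of_side_eq {x y : H.Dart × Bool} (h : side x = side y) : y = x ∨ y = flagOpp x := by
  have h' : ((⟨x.1.edge, x.1.edge_mem⟩ : H.edgeSet), x.2) = (⟨y.1.edge, y.1.edge_mem⟩, y.2) :=
    Sum.inl_injective h
  rw [Prod.mk.injEq, Subtype.mk.injEq, SimpleGraph.dart_edge_eq_iff] at h'
  obtain ⟨h1 | h1, h2⟩ := h'
  · exact Or.inl (Prod.ext h1.symm h2.symm)
  · right
    refine Prod.ext ?_ h2.symm
    change y.1 = x.1.symm
    rw [h1, SimpleGraph.Dart.symm_symm]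

variable (R) in
/-- The vertices at a node: the ends of a side and the vertex at the chosen corner of its face,
unless this face is special; an isolated vertex. -/
def base (q : Node H) : Set U :=
  {a | (∃ x, side x = q ∧ (a = x.1.fst ∨
    R.emb.faceOf x ∉ R.special ∧ a = (R.flag (R.emb.faceOf x)).1.fst)) ∨ ∃ h, q = Sum.inr ⟨a, h⟩}

theorem ncard_base_le [Finite U] (q : Node H) : (R.base q).ncard ≤ 3 := by
  classical
  rcases q with p | ⟨a, ha⟩
  · obtain ⟨x, hx⟩ := exists_side_eq p
    have hs : R.base (Sum.inl p) ⊆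
        ({x.1.fst, x.1.snd, (R.flag (R.emb.faceOf x)).1.fst} : Finset U) := by
      rintro a (⟨y, hy, ha⟩ | ⟨_, h⟩)
      · rw [← hx] at hy
        rcases eq_of_side_eq hy.symm with rfl | rfl
        · rcases ha with rfl | ⟨-, rfl⟩ <;> simp
        · rw [R.faceOf_flagOpp] at ha
          rcases ha with rfl | ⟨-, rfl⟩ <;> simp [flagOpp]
      · simp at h
    refine (Set.ncard_le_ncard hs (Finset.finite_toSet _)).trans ?_
    rw [Set.ncard_coe_finset]
    exact Finset.card_le_three
  · have hs : R.base (Sum.inr ⟨a, ha⟩) ⊆ {a} := by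
      rintro b (⟨y, hy, -⟩ | ⟨_, h⟩)
      · simp [side] at hy
      · simp only [Sum.inr.injEq, Subtype.mk.injEq] at h
        exact h.symm
    refine (Set.ncard_le_ncard hs).trans ?_
    simp

theorem conn_of_anc [Finite U] {a v : U} (h : R.Anc a v) {x y : H.Dart × Bool} (hx : x.1.fst = a)
    (hy : y.1.fst = v) : R.Conn v (side x) (side y) := by
  have hE := Conn.equivalence R v
  induction h using Relation.ReflTransGen.head_induction_on generalizing x with
  | refl => exact conn_of_fst_eq v hx hy
  | @head a c hac hcv ih =>
    let z : H.Dart × Bool := (⟨(a, c), R.parent_adj _ _ hac⟩, true)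
    have h1 : R.Conn a (side x) (side z) := conn_of_fst_eq a hx rfl
    have h2 := ih (x := flagOpp z) rfl
    rw [side_flagOpp] at h2
    exact hE.trans (h1.mono (Relation.ReflTransGen.head hac hcv)) h2

theorem anc_adj {a v : U} (h : R.Anc a v) : a = v ∨ ∃ b, H.Adj v b := by
  rcases Relation.ReflTransGen.cases_tail h with h | ⟨c, -, h⟩
  · exact Or.inl h.symm
  · exact Or.inr ⟨c, (R.parent_adj _ _ h).symm⟩

theorem anc_adj_left {a v : U} (h : R.Anc a v) : a = v ∨ ∃ b, H.Adj a b := by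
  rcases Relation.ReflTransGen.cases_head h with h | ⟨c, h, -⟩
  · exact Or.inl h
  · exact Or.inr ⟨c, R.parent_adj _ _ h⟩

/-- Both nodes are connected to a side at `v`: walk around the face to its chosen vertex if
necessary, then up the forest. If `v` is isolated, its own node is the only one concerned. -/
theorem conn_of_base [Finite U] {v : U} {p q : Node H} {a b : U} (ha : a ∈ R.base p)
    (hav : R.Anc a v) (hb : b ∈ R.base q) (hbv : R.Anc b v) : R.Conn v p q := by
  have hE := Conn.equivalence R v
  by_cases hv : ∃ b, H.Adj v b
  · obtain ⟨c, hc⟩ := hv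
    let z : H.Dart × Bool := (⟨(v, c), hc⟩, true)
    have key : ∀ (p : Node H) (a : U), a ∈ R.base p → R.Anc a v → R.Conn v p (side z) := by
      rintro p a (⟨x, rfl, rfl | ⟨hs, rfl⟩⟩ | ⟨h, -⟩) hav
      · exact conn_of_anc hav rfl rfl
      · exact hE.trans (conn_of_faceOf_eq hs hav rfl (R.faceOf_flag _)) (conn_of_anc hav rfl rfl)
      · rcases anc_adj_left hav with rfl | ⟨b, hb⟩
        · exact absurd hc (h c)
        · exact absurd hb (h b)
    exact hE.trans (key p a ha hav) (hE.symm (key q b hb hbv))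
  · have key : ∀ (p : Node H) (a : U), a ∈ R.base p → R.Anc a v → ∃ h, p = Sum.inr ⟨v, h⟩ := by
      intro p a ha hav
      rcases anc_adj hav with rfl | h
      · rcases ha with ⟨x, rfl, rfl | ⟨-, rfl⟩⟩ | h
        · exact absurd ⟨_, x.1.adj⟩ hv
        · exact absurd ⟨_, (R.flag (R.emb.faceOf x)).1.adj⟩ hv
        · exact h
      · exact absurd h hv
    obtain ⟨h, rfl⟩ := key p a ha hav
    obtain ⟨h', rfl⟩ := key q b hb hbv
    exact hE.refl _

/-- Converse to `conn_of_base`: links with an end below `v` never leave the set of nodes whose bags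
contain `v`. -/
theorem link_base (j : R.Link) {v : U} (h : R.Anc (R.ends j).1 v ∨ R.Anc (R.ends j).2 v) :
    (∃ a ∈ R.base (R.link j).1, R.Anc a v) ∧ ∃ a ∈ R.base (R.link j).2, R.Anc a v := by
  rcases j with ⟨c, hc⟩ | ⟨e, he⟩
  · have hsp : R.emb.faceOf c.out ∉ R.special := fun h => hc (Or.inl h)
    rcases h with h | h
    · exact ⟨⟨_, Or.inl ⟨_, rfl, Or.inl rfl⟩, h⟩,
        ⟨_, Or.inl ⟨_, rfl, Or.inl (R.emb.turn_fst _).symm⟩, h⟩⟩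
    · refine ⟨⟨_, Or.inl ⟨_, rfl, Or.inr ⟨hsp, rfl⟩⟩, h⟩,
        ⟨_, Or.inl ⟨_, rfl, Or.inr ⟨?_, ?_⟩⟩, h⟩⟩
      · rwa [R.faceOf_turn]
      · rw [R.faceOf_turn]
        rfl
  · obtain ⟨e, hadj⟩ := e
    have ho : s((Quot.out e).1, (Quot.out e).2) = e := Quot.out_eq e
    have key : ∀ b : Bool, ∃ a ∈ R.base (Sum.inl (⟨e, hadj⟩, b)), R.Anc a v := by
      intro b
      rcases h with h | h
      · refine ⟨_, Or.inl ⟨(⟨Quot.out e, ?_⟩, b), ?_, Or.inl rfl⟩, h⟩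
        · rw [← SimpleGraph.mem_edgeSet]
          exact ho.symm ▸ hadj
        · simp only [side, Sum.inl.injEq, Prod.mk.injEq, and_true, Subtype.mk.injEq]
          exact ho
      · refine ⟨_, Or.inl ⟨(⟨(Quot.out e).swap, ?_⟩, b), ?_, Or.inl rfl⟩, h⟩
        · refine SimpleGraph.Adj.symm ?_
          rw [← SimpleGraph.mem_edgeSet]
          exact ho.symm ▸ hadj
        · simp only [side, Sum.inl.injEq, Prod.mk.injEq, and_true, Subtype.mk.injEq]
          exact Sym2.eq_swap.trans ho
    exact ⟨key false, key true⟩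

theorem eqvGen_link_of_reachable [Finite U] {a b : U} (h : H.Reachable a b) {p q : Node H}
    (ha : a ∈ R.base p) (hb : b ∈ R.base q) :
    Relation.EqvGen (fun p q => ∃ j, R.link j = (p, q)) p q := by
  have hconn : ∀ v p q, R.Conn v p q → Relation.EqvGen (fun p q => ∃ j, R.link j = (p, q)) p q :=
    fun v p q h => Relation.EqvGen.mono (fun _ _ ⟨j, _, hj⟩ => ⟨j, hj⟩) _ _ h
  obtain ⟨w⟩ := h
  induction w generalizing p with
  | nil => exact hconn _ _ _ (conn_of_base ha Relation.ReflTransGen.refl hb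
      Relation.ReflTransGen.refl)
  | @cons a c b hac w ih =>
    refine Relation.EqvGen.trans _ (side (⟨(a, c), hac⟩, true)) _ (hconn a _ _ ?_) (ih ?_ hb)
    · exact conn_of_base ha Relation.ReflTransGen.refl (Or.inl ⟨_, rfl, Or.inl rfl⟩)
        Relation.ReflTransGen.refl
    · exact Or.inl ⟨flagOpp _, side_flagOpp _, Or.inl rfl⟩

theorem exists_mem_base (q : Node H) : ∃ a, a ∈ R.base q := by
  rcases q with p | ⟨a, ha⟩
  · obtain ⟨x, hx⟩ := exists_side_eq p
    exact ⟨_, Or.inl ⟨x, hx, Or.inl rfl⟩⟩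
  · exact ⟨a, Or.inr ⟨ha, rfl⟩⟩

theorem exists_node [Finite U] (a : U) : ∃ q, a ∈ R.base q := by
  by_cases h : ∃ b, H.Adj a b
  · obtain ⟨b, hb⟩ := h
    exact ⟨_, Or.inl ⟨(⟨(a, b), hb⟩, true), rfl, Or.inl rfl⟩⟩
  · push Not at h
    exact ⟨_, Or.inr ⟨h, rfl⟩⟩

/-- The tree decomposition given by a tree that contains all but some excess links. -/
theorem exists_decomposition_of_isTree [Finite U] {T : SimpleGraph (Node H)} {X : Set R.Link}
    (hT : T.IsTree) (hX : ∀ j ∉ X, T.Adj (R.link j).1 (R.link j).2) :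
    ∃ D : Decomposition H T, ∀ q, ∃ l : Set U, l.ncard ≤ 3 + 2 * X.ncard ∧
      D.bag q = {v | ∃ a ∈ l, R.Anc a v} := by
  have : Finite (H.Dart × Bool) := inferInstance
  have : Finite R.Corner := Quotient.finite _
  -- The ends of the excess links go into every bag. A vertex above one of them is then in all bags;
  -- for any other vertex, all links with an end below it are edges of `T`.
  let l₀ : Set U := (fun j => (R.ends j).1) '' X ∪ (fun j => (R.ends j).2) '' X
  have hl₀ : l₀.ncard ≤ 2 * X.ncard := by
    have h1 := Set.ncard_union_le ((fun j => (R.ends j).1) '' X) ((fun j => (R.ends j).2) '' X)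
    have h2 := Set.ncard_image_le (f := fun j => (R.ends j).1) (Set.toFinite X)
    have h3 := Set.ncard_image_le (f := fun j => (R.ends j).2) (Set.toFinite X)
    change ((fun j => (R.ends j).1) '' X ∪ (fun j => (R.ends j).2) '' X).ncard ≤ _
    omega
  refine ⟨⟨fun q => {v | ∃ a ∈ R.base q ∪ l₀, R.Anc a v}, ?_, ?_⟩, fun q => ⟨R.base q ∪ l₀, ?_, rfl⟩⟩
  · intro a b hab
    refine ⟨side (⟨(a, b), hab⟩, true), ⟨a, Or.inl (Or.inl ⟨_, rfl, Or.inl rfl⟩),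
      Relation.ReflTransGen.refl⟩, ⟨b, Or.inl (Or.inl ⟨flagOpp _, side_flagOpp _, Or.inl rfl⟩),
      Relation.ReflTransGen.refl⟩⟩
  · intro v
    by_cases hv : ∃ a ∈ l₀, R.Anc a v
    · obtain ⟨a, ha, hav⟩ := hv
      have : {q : Node H | v ∈ {v | ∃ a ∈ R.base q ∪ l₀, R.Anc a v}} = Set.univ :=
        Set.eq_univ_of_forall fun q => ⟨a, Or.inr ha, hav⟩
      rw [this]
      exact (SimpleGraph.induceUnivIso T).connected_iff.2 hT.connected
    · set S : Set (Node H) := {q | v ∈ {v | ∃ a ∈ R.base q ∪ l₀, R.Anc a v}} with hS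
      have hbase : ∀ q, q ∈ S ↔ ∃ a ∈ R.base q, R.Anc a v := by
        intro q
        constructor
        · rintro ⟨a, ha | ha, hav⟩
          · exact ⟨a, ha, hav⟩
          · exact absurd ⟨a, ha, hav⟩ hv
        · rintro ⟨a, ha, hav⟩
          exact ⟨a, Or.inl ha, hav⟩
      have key : ∀ p q, R.Conn v p q → (p ∈ S ↔ q ∈ S) ∧
          ∀ (hp : p ∈ S) (hq : q ∈ S), (T.induce S).Reachable ⟨p, hp⟩ ⟨q, hq⟩ := by
        intro p q h
        induction h with
        | rel p q h =>
          obtain ⟨j, hj, hpq⟩ := h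
          have hb := link_base j hj
          rw [hpq] at hb
          have hp := (hbase p).2 hb.1
          have hq := (hbase q).2 hb.2
          refine ⟨iff_of_true hp hq, fun _ _ => SimpleGraph.Adj.reachable ?_⟩
          have hjX : j ∉ X := by
            intro hjX
            rcases hj with hj | hj
            · exact hv ⟨_, Or.inl ⟨j, hjX, rfl⟩, hj⟩
            · exact hv ⟨_, Or.inr ⟨j, hjX, rfl⟩, hj⟩
          have := hX j hjX
          rw [hpq] at this
          exact this
        | refl p => exact ⟨Iff.rfl, fun _ _ => SimpleGraph.Reachable.refl _⟩
        | symm p q _ ih => exact ⟨ih.1.symm, fun hp hq => (ih.2 hq hp).symm⟩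
        | trans p q r _ _ ih1 ih2 =>
          exact ⟨ih1.1.trans ih2.1, fun hp hr =>
            (ih1.2 hp (ih1.1.1 hp)).trans (ih2.2 (ih1.1.1 hp) hr)⟩
      obtain ⟨q₀, hq₀⟩ := exists_node (R := R) v
      have hq₀S : q₀ ∈ S := (hbase q₀).2 ⟨v, hq₀, Relation.ReflTransGen.refl⟩
      rw [SimpleGraph.connected_iff_exists_forall_reachable]
      refine ⟨⟨q₀, hq₀S⟩, fun ⟨q, hq⟩ => ?_⟩
      obtain ⟨a, ha, hav⟩ := (hbase q).1 hq
      exact (key _ _ (conn_of_base hq₀ Relation.ReflTransGen.refl ha hav)).2 hq₀S hq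
  · have h1 := Set.ncard_union_le (R.base q) l₀
    have h2 := ncard_base_le (R := R) q
    omega

end RootedEmbedding

/-! ### Counting the links by Euler's formula -/

namespace RootedEmbedding

variable {U : Type u} {H : SimpleGraph U}

instance [Finite U] (E : SurfaceEmbedding H) : Finite E.Face := inferInstanceAs (Finite (Quot _))

variable (R : RootedEmbedding H)

instance [Finite U] : Finite R.Corner := Quotient.finite _

theorem corner_eq {x y : H.Dart × Bool}
    (h : Quotient.mk R.cornerSetoid x = Quotient.mk R.cornerSetoid y) :
    R.emb.faceOf x = R.emb.faceOf y ∧ x.1.fst = y.1.fst := by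
  have h' : y = x ∨ y = R.emb.turn x := Quotient.exact h
  rcases h' with rfl | rfl
  · exact ⟨rfl, rfl⟩
  · exact ⟨(R.faceOf_turn x).symm, (R.emb.turn_fst x).symm⟩

theorem marked_out {x : H.Dart × Bool} (hx : R.Marked x) :
    R.Marked (Quotient.mk R.cornerSetoid x).out := by
  have hout : x = (Quotient.mk R.cornerSetoid x).out ∨
      x = R.emb.turn (Quotient.mk R.cornerSetoid x).out := Quotient.mk_out (s := R.cornerSetoid) x
  rcases hout with h | h
  · rwa [← h]
  · rwa [← R.marked_turn, ← h]

/-- The vertices of the special faces. -/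
def specialVerts : Set U := {a | ∃ x, R.emb.faceOf x ∈ R.special ∧ x.1.fst = a}

/-- The roots that are not on a special face. -/
def roots : Set U := {a | R.parent a = none ∧ a ∉ R.specialVerts}

/-- Each edge has four flags and each corner has two. -/
theorem card_corner_le [Finite U] : Nat.card R.Corner ≤ 2 * Nat.card H.edgeSet := by
  classical
  have := Fintype.ofFinite U
  have h1 : Nat.card (H.Dart × Bool) = 2 * Nat.card H.edgeSet * 2 := by
    rw [Nat.card_prod, Nat.card_eq_fintype_card, Nat.card_eq_fintype_card, Nat.card_eq_fintype_card,
      H.dart_card_eq_twice_card_edges, SimpleGraph.edgeFinset_card, Fintype.card_bool]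
  have h2 : Nat.card (R.Corner × Bool) ≤ Nat.card (H.Dart × Bool) := by
    have hmk : ∀ p : R.Corner × Bool, Quotient.mk R.cornerSetoid
        (bif p.2 then p.1.out else R.emb.turn p.1.out) = p.1 := by
      rintro ⟨c, b⟩
      cases b
      · refine Eq.trans ?_ (Quotient.out_eq c)
        exact Quotient.sound (Or.inr (R.emb.turn_turn _).symm)
      · exact Quotient.out_eq c
    refine Nat.card_le_card_of_injective
      (fun p : R.Corner × Bool => bif p.2 then p.1.out else R.emb.turn p.1.out) fun p q h => ?_
    have hpq : p.1 = q.1 := by rw [← hmk p, ← hmk q]; exact congrArg _ h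
    obtain ⟨c, b⟩ := p
    obtain ⟨c', b'⟩ := q
    obtain rfl : c = c' := hpq
    have := R.emb.turn_ne c.out
    cases b <;> cases b'
    · rfl
    · exact absurd h this
    · exact absurd h.symm this
    · rfl
  rw [Nat.card_prod, Nat.card_eq_fintype_card (α := Bool), Fintype.card_bool] at h2
  omega

/-- Each non-special face has its chosen corner and each vertex of a special face has a corner
there; all these marked corners are distinct. -/
theorem card_marked_ge [Finite U] : Nat.card R.emb.Face + R.specialVerts.ncard ≤
    Nat.card {c : R.Corner // R.Marked c.out} + R.special.ncard := by
  have h1 : Nat.card (↥(R.specialᶜ) ⊕ R.specialVerts) ≤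
      Nat.card {c : R.Corner // R.Marked c.out} := by
    choose x hx hxa using fun a : R.specialVerts => a.2
    have hin : ∀ f : ↥(R.specialᶜ), R.Marked (R.flag f.1) := fun f =>
      Or.inr (Or.inl (by rw [R.faceOf_flag]))
    have hfa : ∀ (f : ↥(R.specialᶜ)) (a : R.specialVerts),
        Quotient.mk R.cornerSetoid (R.flag f.1) ≠ Quotient.mk R.cornerSetoid (x a) := by
      intro f a h
      have := (R.corner_eq h).1
      rw [R.faceOf_flag] at this
      exact f.2 (this ▸ hx a)
    refine Nat.card_le_card_of_injective (Sum.elim (fun f => ⟨_, R.marked_out (hin f)⟩)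
      (fun a => ⟨_, R.marked_out (Or.inl (hx a))⟩)) ?_
    rintro (f | a) (f' | a') h
    · have := (R.corner_eq (congrArg Subtype.val h)).1
      rw [R.faceOf_flag, R.faceOf_flag] at this
      rw [Subtype.ext this]
    · exact absurd (congrArg Subtype.val h) (hfa f a')
    · exact absurd (congrArg Subtype.val h).symm (hfa f' a)
    · have := (R.corner_eq (congrArg Subtype.val h)).2
      rw [hxa, hxa] at this
      rw [Subtype.ext this]
  rw [Nat.card_sum, Nat.card_coe_set_eq, Nat.card_coe_set_eq] at h1
  have h2 := Set.ncard_add_ncard_compl R.special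
  omega

/-- Every vertex with a parent contributes its own forest edge, as ranks rule out that two vertices
are parents of each other. -/
theorem card_forest_ge [Finite U] : Nat.card U ≤
    Nat.card {e : H.edgeSet // R.IsForestEdge e} + (R.specialVerts.ncard + R.roots.ncard) := by
  have h1 : {a | R.parent a = none}ᶜ.ncard ≤ Nat.card {e : H.edgeSet // R.IsForestEdge e} := by
    rw [← Nat.card_coe_set_eq]
    have hp : ∀ a : ↥({a | R.parent a = none}ᶜ), ∃ b, R.parent a.1 = some b := fun a =>
      Option.ne_none_iff_exists'.1 a.2
    choose p hp using hp
    refine Nat.card_le_card_of_injective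
      (fun a => ⟨⟨s(a.1, p a), R.parent_adj _ _ (hp a)⟩, a.1, p a, hp a, rfl⟩) fun a a' h => ?_
    have h' : s(a.1, p a) = s(a'.1, p a') := congrArg (fun e => e.1.1) h
    rw [Sym2.eq_iff] at h'
    rcases h' with h' | h'
    · exact Subtype.ext h'.1
    · have h1 := R.parent_rank _ _ (hp a)
      have h2 := R.parent_rank _ _ (hp a')
      rw [h'.2] at h1
      rw [← h'.1] at h2
      omega
  have h2 := Set.ncard_add_ncard_compl {a | R.parent a = none}
  have h3 : {a | R.parent a = none}.ncard ≤ R.specialVerts.ncard + R.roots.ncard := by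
    refine (Set.ncard_le_ncard fun a ha => ?_).trans (Set.ncard_union_le _ _)
    by_cases h : a ∈ R.specialVerts
    · exact Or.inl h
    · exact Or.inr ⟨ha, h⟩
  omega

theorem card_subtype_add {α : Type*} [Finite α] (p : α → Prop) :
    Nat.card {a // p a} + Nat.card {a // ¬ p a} = Nat.card α :=
  Set.ncard_add_ncard_compl {a | p a}

theorem card_link_le [Finite U] : Nat.card R.Link + Nat.card R.emb.Face + Nat.card U ≤
    3 * Nat.card H.edgeSet + R.special.ncard + R.roots.ncard := by
  have h1 := R.card_corner_le
  have h2 := R.card_marked_ge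
  have h3 := R.card_forest_ge
  have h4 := card_subtype_add fun c : R.Corner => R.Marked c.out
  have h5 := card_subtype_add fun e : H.edgeSet => R.IsForestEdge e
  rw [Nat.card_sum]
  omega

/-- A graph embedded in a surface has a tree decomposition in which every bag is the union of few
paths to the roots. -/
theorem exists_decomposition [Finite U] {g s : ℕ} (hg : R.emb.eulerGenus ≤ g)
    (hs : R.special.ncard ≤ s) (hr : R.roots.ncard ≤ Nat.card H.ConnectedComponent) :
    ∃ (n : ℕ) (T : SimpleGraph (Fin n)) (D : Decomposition H T), T.IsTree ∧
      ∀ q, ∃ l : Set U, l.ncard ≤ 2 * (g + s) + 3 ∧ D.bag q = {v | ∃ a ∈ l, R.Anc a v} := by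
  rcases isEmpty_or_nonempty U with hU | hU
  · refine ⟨1, ⊥, ⟨fun _ => ∅, fun a => isEmptyElim a, fun a => isEmptyElim a⟩,
      SimpleGraph.IsTree.of_subsingleton, fun q => ⟨∅, by simp, by simp⟩⟩
  obtain ⟨a⟩ := hU
  obtain ⟨q, -⟩ := exists_node (R := R) a
  have : Nonempty (Node H) := ⟨q⟩
  choose pt hpt using exists_mem_base (R := R)
  obtain ⟨T, X, hT, hX, hcard⟩ := exists_isTree_of_links R.link
    (fun q => H.connectedComponentMk (pt q)) fun p q h =>
      eqvGen_link_of_reachable (SimpleGraph.ConnectedComponent.exact h) (hpt p) (hpt q)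
  obtain ⟨D, hD⟩ := exists_decomposition_of_isTree hT hX
  obtain ⟨n, T', D', hT', hD'⟩ := D.exists_fin hT
  refine ⟨n, T', D', hT', fun q => ?_⟩
  obtain ⟨q', hq'⟩ := hD' q
  obtain ⟨l, hl, hb⟩ := hD q'
  refine ⟨l, hl.trans ?_, hq'.trans hb⟩
  -- There are `2|E|` nodes plus the isolated vertices. Substituting this and `card_link_le` into
  -- `hcard`, and bounding the roots by the components, leaves `|X| ≤ g + s`.
  have h1 := R.card_link_le
  rw [Nat.card_sum, Nat.card_prod, Nat.card_eq_fintype_card (α := Bool), Fintype.card_bool] at hcard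
  unfold SurfaceEmbedding.eulerGenus at hg
  omega

end RootedEmbedding

/-! ### Consequences of goodness -/

theorem Decomposition.layeredWidth_le_iff {V : Type u} {W : Type v} {G : SimpleGraph V}
    {H : SimpleGraph W} (D : Decomposition G H) (L : Layering G) (l : ℕ∞) :
    D.layeredWidth L ≤ l ↔ ∀ x i, (D.bag x ∩ L.layer i).encard ≤ l := by
  simp [Decomposition.layeredWidth]

theorem IsGood.exists_decomposition {V : Type u} {G : SimpleGraph V} {l : ℕ} (h : IsGood G l) :
    ∃ (L : Layering G) (n : ℕ) (T : SimpleGraph (Fin n)) (D : Decomposition G T),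
      T.IsTree ∧ D.layeredWidth L ≤ l := by
  obtain ⟨L, n, T, D, -, hT, hD⟩ := h ∅ (by simp) (by simp)
  exact ⟨L, n, T, D, hT, hD⟩

theorem IsGood.layeredTreewidth_le {V : Type u} {G : SimpleGraph V} {l : ℕ} (h : IsGood G l) :
    layeredTreewidth G ≤ l := by
  obtain ⟨L, n, T, D, hT, hD⟩ := h.exists_decomposition
  exact iInf_le_of_le n (iInf_le_of_le T (iInf_le_of_le hT (iInf_le_of_le D (iInf_le_of_le L hD))))

/-- Delete a bag that balances `S`. Adjacent remaining vertices lie in the same branch, so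
distributing the branches over two groups is a separation whose intersection is the bag. -/
theorem IsGood.admitsLayeredSeparations {V : Type u} [Finite V] {G : SimpleGraph V} {l : ℕ}
    (h : IsGood G l) : AdmitsLayeredSeparations G l := by
  obtain ⟨L, n, T, D, hT, hD⟩ := h.exists_decomposition
  rw [D.layeredWidth_le_iff] at hD
  refine ⟨L, fun S => ?_⟩
  obtain ⟨x, hx⟩ := D.exists_balanced_bag hT S
  have hbr : ∀ a, ∃ y, a ∉ D.bag x → ∃ z, a ∈ D.bag z ∧ Branch T x y z := by
    intro a
    by_cases ha : a ∈ D.bag x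
    · exact ⟨x, fun h => absurd ha h⟩
    · obtain ⟨z, hz⟩ := D.exists_mem_bag a
      obtain ⟨y, hy⟩ := exists_branch hT.connected (x := x) (z := z) (by rintro rfl; exact ha hz)
      exact ⟨y, fun _ => ⟨z, hz, hy⟩⟩
  choose br hbr using hbr
  have hadj : ∀ a b, G.Adj a b → a ∉ D.bag x → b ∉ D.bag x → br a = br b := by
    intro a b hab ha hb
    obtain ⟨w, haw, hbw⟩ := D.edge_mem a b hab
    obtain ⟨z, haz, hz⟩ := hbr a ha
    obtain ⟨z', hbz, hz'⟩ := hbr b hb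
    exact (hz.of_mem (D.connected a) ha haz haw).unique hT.isAcyclic
      (hz'.of_mem (D.connected b) hb hbz hbw)
  obtain ⟨Z, hZ, hZ'⟩ := exists_balanced_split {a ∈ S | a ∉ D.bag x} br S.ncard
    (Set.ncard_le_ncard fun a h => h.1) fun y => by
      refine le_trans (Nat.mul_le_mul_left 2 (Set.ncard_le_ncard ?_)) (hx y)
      rintro a ⟨⟨haS, ha⟩, rfl⟩
      exact ⟨haS, ha, hbr a ha⟩
  let A : Set V := {a | a ∉ D.bag x → br a ∈ Z}
  let B : Set V := {a | a ∉ D.bag x → br a ∉ Z}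
  have hcast : ∀ X : Set V, X.encard = (X.ncard : ℕ∞) := fun X =>
    ((Set.toFinite X).cast_ncard_eq).symm
  refine ⟨(⊤ : G.Subgraph).induce A, (⊤ : G.Subgraph).induce B, ?_, ?_, ?_, ?_⟩
  · ext a b
    · simp only [SimpleGraph.Subgraph.verts_sup, SimpleGraph.Subgraph.induce_verts, Set.mem_union,
        SimpleGraph.Subgraph.verts_top, Set.mem_univ, iff_true, A, B, Set.mem_ofPred_eq]
      tauto
    · simp only [SimpleGraph.Subgraph.sup_adj, SimpleGraph.Subgraph.induce_adj,
        SimpleGraph.Subgraph.top_adj, A, B, Set.mem_ofPred_eq]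
      have := hadj a b
      by_cases hab : G.Adj a b
      · by_cases ha : a ∈ D.bag x
        · simp only [hab, ha]
          tauto
        · by_cases hb : b ∈ D.bag x
          · simp only [hab, hb]
            tauto
          · rw [hadj a b hab ha hb]
            simp only [hab, ha, hb]
            tauto
      · simp [hab]
  · intro i
    refine (Set.encard_le_encard ?_).trans (hD x i)
    rintro a ⟨hi, haA, haB⟩
    refine ⟨by_contra fun ha => ?_, hi⟩
    exact haB ha (haA ha)
  · rw [hcast, hcast]
    refine le_trans ?_ (by exact_mod_cast hZ : ((3 * _ : ℕ) : ℕ∞) ≤ ((2 * S.ncard : ℕ) : ℕ∞))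
    rw [Nat.cast_mul]
    refine mul_le_mul_right (Nat.cast_le.2 (Set.ncard_le_ncard ?_)) _
    rintro a ⟨⟨haA, haB⟩, haS⟩
    have hab : a ∉ D.bag x := fun h => haB fun h' => absurd h h'
    exact ⟨⟨haS, hab⟩, haA hab⟩
  · rw [hcast, hcast]
    refine le_trans ?_ (by exact_mod_cast hZ' : ((3 * _ : ℕ) : ℕ∞) ≤ ((2 * S.ncard : ℕ) : ℕ∞))
    rw [Nat.cast_mul]
    refine mul_le_mul_right (Nat.cast_le.2 (Set.ncard_le_ncard ?_)) _
    rintro a ⟨⟨haB, haA⟩, haS⟩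
    have hab : a ∉ D.bag x := fun h => haA fun h' => absurd h h'
    exact ⟨⟨haS, hab⟩, haB hab⟩

theorem encard_biUnion_le {α ι : Type*} (s : Finset ι) (f : ι → Set α) (c : ℕ∞)
    (h : ∀ i ∈ s, (f i).encard ≤ c) : (⋃ i ∈ s, f i).encard ≤ s.card * c := by
  classical
  induction s using Finset.induction_on with
  | empty => simp
  | insert a s ha ih =>
    rw [Finset.set_biUnion_insert, Finset.card_insert_of_notMem ha, Nat.cast_add, Nat.cast_one,
      add_mul, one_mul, add_comm]
    exact (Set.encard_union_le _ _).trans (add_le_add (h a (by simp))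
      (ih fun i hi => h i (by simp [hi])))

theorem Layering.idx_le_of_walk {V : Type u} {G : SimpleGraph V} (L : Layering G) {a b : V}
    (p : G.Walk a b) : L.idx a ≤ L.idx b + p.length := by
  induction p with
  | nil => simp
  | cons h p ih =>
    have := L.adj_le _ _ h
    rw [SimpleGraph.Walk.length_cons]
    omega

theorem IsGood.treewidth_lt {V : Type u} [Finite V] {G : SimpleGraph V} {l : ℕ} (h : IsGood G l)
    (hl : 0 < l) (hG : G.Connected) : treewidth G < ((l * (G.diam + 1) : ℕ) : ℕ∞) := by
  obtain ⟨L, n, T, D, hT, hD⟩ := h.exists_decomposition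
  rw [D.layeredWidth_le_iff] at hD
  have := hG.nonempty
  -- The first layers may be empty, so the `diam + 1` relevant layers are counted from the smallest
  -- index that occurs.
  obtain ⟨a₀, ha₀⟩ := Finite.exists_min L.idx
  have hidx : ∀ a, L.idx a ≤ L.idx a₀ + G.diam := by
    intro a
    obtain ⟨p, hp⟩ := hG.exists_walk_length_eq_dist a a₀
    have h1 := L.idx_le_of_walk p
    have h2 : G.dist a a₀ ≤ G.diam := SimpleGraph.dist_le_diam
      (SimpleGraph.connected_iff_ediam_ne_top.1 hG)
    omega
  have hbag : ∀ x, (D.bag x).encard ≤ ((l * (G.diam + 1) : ℕ) : ℕ∞) := by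
    intro x
    have hsub : D.bag x ⊆ ⋃ i ∈ Finset.Icc (L.idx a₀) (L.idx a₀ + G.diam), D.bag x ∩ L.layer i := by
      intro a ha
      simp only [Set.mem_iUnion, Finset.mem_Icc]
      exact ⟨L.idx a, ⟨ha₀ a, hidx a⟩, ha, rfl⟩
    refine (Set.encard_le_encard hsub).trans
      ((encard_biUnion_le _ _ _ fun i _ => hD x i).trans (le_of_eq ?_))
    rw [Nat.card_Icc, ← Nat.cast_mul, mul_comm]
    congr 2
    omega
  have hw : D.width ≤ ((l * (G.diam + 1) - 1 : ℕ) : ℕ∞) := by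
    unfold Decomposition.width
    rw [tsub_le_iff_right]
    refine (iSup_le hbag).trans ?_
    rw [← Nat.cast_one (R := ℕ∞), ← Nat.cast_add, Nat.cast_le]
    omega
  refine lt_of_le_of_lt (iInf_le_of_le n (iInf_le_of_le T (iInf_le_of_le hT (iInf_le_of_le D hw)))) ?_
  rw [Nat.cast_lt]
  have : 0 < l * (G.diam + 1) := by positivity
  omega

/-! ### Clique-sums -/

/-- Decompositions of two graphs, glued along an edge between two bags containing the common
vertices. -/
theorem exists_decomposition_glue {V₁ V₂ V N₁ N₂ : Type*} [Finite N₁] [Finite N₂]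
    {G₁ : SimpleGraph V₁} {G₂ : SimpleGraph V₂} {G : SimpleGraph V} {T₁ : SimpleGraph N₁}
    {T₂ : SimpleGraph N₂} (hT₁ : T₁.IsTree) (hT₂ : T₂.IsTree) (D₁ : Decomposition G₁ T₁)
    (D₂ : Decomposition G₂ T₂) (f₁ : V₁ ↪ V) (f₂ : V₂ ↪ V)
    (hf : Set.range f₁ ∪ Set.range f₂ = Set.univ) (hG : G ≤ G₁.map f₁ ⊔ G₂.map f₂) {x₁ : N₁}
    {x₂ : N₂} (hx₁ : f₁ ⁻¹' Set.range f₂ ⊆ D₁.bag x₁) (hx₂ : f₂ ⁻¹' Set.range f₁ ⊆ D₂.bag x₂) :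
    ∃ (T : SimpleGraph (N₁ ⊕ N₂)) (D : Decomposition G T), T.IsTree ∧
      D.bag = Sum.elim (fun x => f₁ '' D₁.bag x) (fun x => f₂ '' D₂.bag x) := by
  refine ⟨_, ⟨Sum.elim (fun x => f₁ '' D₁.bag x) (fun x => f₂ '' D₂.bag x), ?_, ?_⟩,
    isTree_sum_sup_edge hT₁ hT₂ x₁ x₂, rfl⟩
  · intro a b hab
    rcases hG hab with h | h
    · obtain ⟨-, a, b, h, rfl, rfl⟩ := h
      obtain ⟨x, ha, hb⟩ := D₁.edge_mem a b h
      exact ⟨Sum.inl x, ⟨a, ha, rfl⟩, ⟨b, hb, rfl⟩⟩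
    · obtain ⟨-, a, b, h, rfl, rfl⟩ := h
      obtain ⟨x, ha, hb⟩ := D₂.edge_mem a b h
      exact ⟨Sum.inr x, ⟨a, ha, rfl⟩, ⟨b, hb, rfl⟩⟩
  · intro v
    set T := (T₁ ⊕g T₂) ⊔ SimpleGraph.edge (Sum.inl x₁) (Sum.inr x₂) with hT
    set S : Set (N₁ ⊕ N₂) :=
      {x | v ∈ Sum.elim (fun x => f₁ '' D₁.bag x) (fun x => f₂ '' D₂.bag x) x} with hS
    have hl : ∀ a, f₁ a = v → ∀ x y (hx : Sum.inl x ∈ S) (hy : Sum.inl y ∈ S),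
        (T.induce S).Reachable ⟨Sum.inl x, hx⟩ ⟨Sum.inl y, hy⟩ := by
      rintro a rfl x y hx hy
      have hm : ∀ x, Sum.inl x ∈ S → a ∈ D₁.bag x := by
        rintro x ⟨a', ha', he⟩
        rwa [← f₁.injective he]
      let φ : T₁.induce {x | a ∈ D₁.bag x} →g T.induce S :=
        ⟨fun x => ⟨Sum.inl x.1, ⟨a, x.2, rfl⟩⟩, fun {x y} h => Or.inl (by simpa using h)⟩
      exact ((D₁.connected a).preconnected ⟨x, hm x hx⟩ ⟨y, hm y hy⟩).map φ
    have hr : ∀ a, f₂ a = v → ∀ x y (hx : Sum.inr x ∈ S) (hy : Sum.inr y ∈ S),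
        (T.induce S).Reachable ⟨Sum.inr x, hx⟩ ⟨Sum.inr y, hy⟩ := by
      rintro a rfl x y hx hy
      have hm : ∀ x, Sum.inr x ∈ S → a ∈ D₂.bag x := by
        rintro x ⟨a', ha', he⟩
        rwa [← f₂.injective he]
      let φ : T₂.induce {x | a ∈ D₂.bag x} →g T.induce S :=
        ⟨fun x => ⟨Sum.inr x.1, ⟨a, x.2, rfl⟩⟩, fun {x y} h => Or.inl (by simpa using h)⟩
      exact ((D₂.connected a).preconnected ⟨x, hm x hx⟩ ⟨y, hm y hy⟩).map φ
    have hlr : ∀ a b, f₁ a = v → f₂ b = v → ∀ x y (hx : Sum.inl x ∈ S) (hy : Sum.inr y ∈ S),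
        (T.induce S).Reachable ⟨Sum.inl x, hx⟩ ⟨Sum.inr y, hy⟩ := by
      intro a b ha hb x y hx hy
      have h₁ : Sum.inl x₁ ∈ S := ⟨a, hx₁ ⟨b, hb.trans ha.symm⟩, ha⟩
      have h₂ : Sum.inr x₂ ∈ S := ⟨b, hx₂ ⟨a, ha.trans hb.symm⟩, hb⟩
      refine (hl a ha x x₁ hx h₁).trans (SimpleGraph.Reachable.trans ?_ (hr b hb x₂ y h₂ hy))
      refine SimpleGraph.Adj.reachable (Or.inr ?_)
      rw [SimpleGraph.edge_adj]
      simp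
    have hne : S.Nonempty := by
      rcases hf.symm ▸ Set.mem_univ v with ⟨a, ha⟩ | ⟨b, hb⟩
      · obtain ⟨x, hx⟩ := D₁.exists_mem_bag a
        exact ⟨Sum.inl x, a, hx, ha⟩
      · obtain ⟨x, hx⟩ := D₂.exists_mem_bag b
        exact ⟨Sum.inr x, b, hx, hb⟩
    have := hne.to_subtype
    refine ⟨?_⟩
    rintro ⟨x | x, hx⟩ ⟨y | y, hy⟩
    · obtain ⟨a, -, ha⟩ := hx
      exact hl a ha _ _ _ _
    · obtain ⟨a, -, ha⟩ := id hx
      obtain ⟨b, -, hb⟩ := id hy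
      exact hlr a b ha hb _ _ _ _
    · obtain ⟨a, -, ha⟩ := id hy
      obtain ⟨b, -, hb⟩ := id hx
      exact (hlr a b ha hb _ _ hy hx).symm
    · obtain ⟨a, -, ha⟩ := hx
      exact hr a ha _ _ _ _

/-- Layer `G₁` from `K`, and `G₂` from the common vertices in the first layer `i` of `G₁` that the
common clique meets. This set lies in one bag and one layer, so it is small enough for goodness.
Shifted by `i`, the two layerings agree, since any other common vertex is in layer `i + 1` of `G₁`
and layer 1 of `G₂`. -/
theorem exists_decomposition_of_cliqueSum {V₁ : Type u} {V₂ : Type v} {V : Type w}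
    {G₁ : SimpleGraph V₁} {G₂ : SimpleGraph V₂} {G : SimpleGraph V} {l : ℕ} (h₁ : IsGood G₁ l)
    (h₂ : IsGood G₂ l) (f₁ : V₁ ↪ V) (f₂ : V₂ ↪ V)
    (hf : Set.range f₁ ∪ Set.range f₂ = Set.univ) (hC₁ : G₁.IsClique (f₁ ⁻¹' Set.range f₂))
    (hC₂ : G₂.IsClique (f₂ ⁻¹' Set.range f₁)) (hG : G ≤ G₁.map f₁ ⊔ G₂.map f₂) {K : Set V}
    (hK : G.IsClique K) (hKl : K.encard ≤ l) (hK₁ : K ⊆ Set.range f₁) :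
    ∃ (L : Layering G) (n : ℕ) (T : SimpleGraph (Fin n)) (D : Decomposition G T),
      L.layer 0 = K ∧ T.IsTree ∧ D.layeredWidth L ≤ l := by
  obtain ⟨L₁, n₁, T₁, D₁, hL₁, hT₁, hD₁⟩ := h₁ (f₁ ⁻¹' K) (by
      intro a ha b hb hab
      rcases hG (hK ha hb (f₁.injective.ne hab)) with h | h
      · obtain ⟨-, a', b', h, h1, h2⟩ := h
        rwa [← f₁.injective h1, ← f₁.injective h2]
      · obtain ⟨-, a', b', h, h1, h2⟩ := h
        exact hC₁ ⟨a', h1⟩ ⟨b', h2⟩ hab) (by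
      rwa [← f₁.injective.encard_image, Set.image_preimage_eq_of_subset hK₁])
  obtain ⟨x₁, hx₁⟩ := D₁.exists_subset_bag hT₁ hC₁
  rw [D₁.layeredWidth_le_iff] at hD₁
  -- Without common vertices, `i = 0` and layer 0 of `L₂` is empty, so no vertex of `G₂` gets into
  -- layer 0.
  let i := sInf (L₁.idx '' (f₁ ⁻¹' Set.range f₂))
  obtain ⟨L₂, n₂, T₂, D₂, hL₂, hT₂, hD₂⟩ := h₂ {b | ∃ a, f₁ a = f₂ b ∧ L₁.idx a = i}
    (hC₂.subset (by rintro b ⟨a, ha, -⟩; exact ⟨a, ha⟩)) (by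
      refine le_trans ?_ (hD₁ x₁ i)
      rw [← f₁.injective.encard_image, ← f₂.injective.encard_image]
      refine Set.encard_le_encard ?_
      rintro _ ⟨b, ⟨a, ha, hi⟩, rfl⟩
      exact ⟨a, ⟨hx₁ ⟨b, ha.symm⟩, hi⟩, ha⟩)
  obtain ⟨x₂, hx₂⟩ := D₂.exists_subset_bag hT₂ hC₂
  rw [D₂.layeredWidth_le_iff] at hD₂
  have hL₂' : ∀ b, L₂.idx b = 0 ↔ ∃ a, f₁ a = f₂ b ∧ L₁.idx a = i := fun b =>
    Set.ext_iff.1 hL₂ b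
  have hcons : ∀ a b, f₁ a = f₂ b → L₁.idx a = i + L₂.idx b := by
    intro a b hab
    have ha : a ∈ f₁ ⁻¹' Set.range f₂ := ⟨b, hab.symm⟩
    have hia : i ≤ L₁.idx a := Nat.sInf_le ⟨a, ha, rfl⟩
    by_cases h : L₁.idx a = i
    · rw [(hL₂' b).2 ⟨a, hab, h⟩, h, add_zero]
    obtain ⟨a₀, ⟨b₀, hb₀⟩, hi₀⟩ : i ∈ L₁.idx '' (f₁ ⁻¹' Set.range f₂) :=
      Nat.sInf_mem ⟨_, a, ha, rfl⟩
    have h1 := L₁.adj_le a a₀ (hC₁ ha ⟨b₀, hb₀⟩ (by rintro rfl; exact h hi₀))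
    have h0 : L₂.idx b₀ = 0 := (hL₂' b₀).2 ⟨a₀, hb₀.symm, hi₀⟩
    have hb : L₂.idx b ≠ 0 := by
      intro h'
      obtain ⟨a', ha', hi'⟩ := (hL₂' b).1 h'
      rw [← hab] at ha'
      rw [f₁.injective ha'] at hi'
      exact h hi'
    have h2 := L₂.adj_le b b₀ (hC₂ ⟨a, hab⟩ ⟨a₀, hb₀.symm⟩ (by rintro rfl; exact hb h0))
    omega
  have hidx : ∀ v, ∃ m, (∀ a, f₁ a = v → m = L₁.idx a) ∧ ∀ b, f₂ b = v → m = i + L₂.idx b := by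
    intro v
    rcases hf.symm ▸ Set.mem_univ v with ⟨a, ha⟩ | ⟨b, hb⟩
    · exact ⟨L₁.idx a, fun a' h => by rw [f₁.injective (h.trans ha.symm)],
        fun b h => hcons a b (ha.trans h.symm)⟩
    · exact ⟨i + L₂.idx b, fun a h => (hcons a b (h.trans hb.symm)).symm,
        fun b' h => by rw [f₂.injective (h.trans hb.symm)]⟩
  choose idx hidx₁ hidx₂ using hidx
  let L : Layering G := ⟨idx, by
    intro v w hvw
    rcases hG hvw with h | h
    · obtain ⟨-, a, b, h, h1, h2⟩ := h
      rw [hidx₁ v a h1, hidx₁ w b h2]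
      exact L₁.adj_le a b h
    · obtain ⟨-, a, b, h, h1, h2⟩ := h
      rw [hidx₂ v a h1, hidx₂ w b h2]
      have := L₂.adj_le a b h
      omega⟩
  obtain ⟨T, D, hT, hD⟩ := exists_decomposition_glue hT₁ hT₂ D₁ D₂ f₁ f₂ hf hG hx₁ hx₂
  obtain ⟨n, T', D', hT', hD'⟩ := D.exists_fin hT
  refine ⟨L, n, T', D', ?_, hT', ?_⟩
  · ext v
    change idx v = 0 ↔ v ∈ K
    rcases hf.symm ▸ Set.mem_univ v with ⟨a, ha⟩ | ⟨b, hb⟩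
    · rw [hidx₁ v a ha, ← ha]
      exact Set.ext_iff.1 hL₁ a
    · rw [hidx₂ v b hb]
      constructor
      · intro h
        obtain ⟨a, ha, hi⟩ := (hL₂' b).1 (by omega)
        rw [← hb, ← ha]
        exact (Set.ext_iff.1 hL₁ a).1 (show L₁.idx a = 0 by omega)
      · intro h
        obtain ⟨a, ha⟩ := hK₁ h
        rw [← hcons a b (ha.trans hb.symm)]
        exact (Set.ext_iff.1 hL₁ a).2 (show f₁ a ∈ K from ha ▸ h)
  · rw [D'.layeredWidth_le_iff]
    intro y j
    obtain ⟨x, hx⟩ := hD' y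
    rw [hx, hD]
    rcases x with x | x
    · refine le_trans ?_ (hD₁ x j)
      rw [← f₁.injective.encard_image]
      refine Set.encard_le_encard ?_
      rintro _ ⟨⟨a, ha, rfl⟩, hj⟩
      exact ⟨a, ⟨ha, (hidx₁ _ a rfl).symm.trans hj⟩, rfl⟩
    · refine le_trans ?_ (hD₂ x (j - i))
      rw [← f₂.injective.encard_image]
      refine Set.encard_le_encard ?_
      rintro _ ⟨⟨b, hb, rfl⟩, hj⟩
      refine ⟨b, ⟨hb, ?_⟩, rfl⟩
      have h1 := hidx₂ _ b rfl
      have h2 : idx (f₂ b) = j := hj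
      change L₂.idx b = j - i
      omega

/-- A clique of the sum lies in one summand, because every edge comes from one of them. -/
theorem IsGood.cliqueSum {V₁ : Type u} {V₂ : Type v} {V : Type w}
    {G₁ : SimpleGraph V₁} {G₂ : SimpleGraph V₂} {G : SimpleGraph V} {l : ℕ} (h₁ : IsGood G₁ l)
    (h₂ : IsGood G₂ l) (h : IsCliqueSum G₁ G₂ G) : IsGood G l := by
  obtain ⟨f₁, f₂, hf, hC₁, hC₂, hG, -⟩ := h
  intro K hK hKl
  by_cases hK₁ : K ⊆ Set.range f₁
  · exact exists_decomposition_of_cliqueSum h₁ h₂ f₁ f₂ hf hC₁ hC₂ hG hK hKl hK₁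
  refine exists_decomposition_of_cliqueSum h₂ h₁ f₂ f₁ (by rwa [Set.union_comm]) hC₂ hC₁
    (by rwa [sup_comm]) hK hKl fun v hv => ?_
  obtain ⟨w, hw, hw₁⟩ := Set.not_subset.1 hK₁
  by_cases hvw : v = w
  · subst hvw
    exact (hf.symm ▸ Set.mem_univ v : v ∈ Set.range f₁ ∪ Set.range f₂).resolve_left hw₁
  rcases hG (hK hv hw hvw) with h | h
  · obtain ⟨-, a, b, h, -, h2⟩ := h
    exact absurd ⟨b, h2⟩ hw₁
  · obtain ⟨-, a, b, h, h1, -⟩ := h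
    exact ⟨a, h1⟩

/-! ### Adding vortices and apex vertices to a decomposition -/

/-- A union of connected sets that is connected itself, since the sets are indexed by the vertices
of a connected graph and meet along its edges. -/
theorem connected_biUnion {N W : Type*} {T : SimpleGraph N} {A : SimpleGraph W} {X : Set W}
    (hX : (A.induce X).Connected) (S : W → Set N) (hS : ∀ w ∈ X, (T.induce (S w)).Connected)
    (hadj : ∀ w ∈ X, ∀ w' ∈ X, A.Adj w w' → (S w ∩ S w').Nonempty) :
    (T.induce {q | ∃ w ∈ X, q ∈ S w}).Connected := by
  have h1 : ∀ w (hw : w ∈ X) q q' (hq : q ∈ S w) (hq' : q' ∈ S w),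
      (T.induce {q | ∃ w ∈ X, q ∈ S w}).Reachable ⟨q, w, hw, hq⟩ ⟨q', w, hw, hq'⟩ := by
    intro w hw q q' hq hq'
    have hle : S w ≤ {q | ∃ w ∈ X, q ∈ S w} := fun q hq => ⟨w, hw, hq⟩
    exact ((hS w hw).preconnected ⟨q, hq⟩ ⟨q', hq'⟩).map (SimpleGraph.induceHomOfLE T hle).toHom
  have h2 : ∀ w w' : X, (A.induce X).Walk w w' → ∀ q q' (hq : q ∈ S w) (hq' : q' ∈ S w'),
      (T.induce {q | ∃ w ∈ X, q ∈ S w}).Reachable ⟨q, w, w.2, hq⟩ ⟨q', w', w'.2, hq'⟩ := by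
    intro w w' p
    induction p with
    | nil => exact h1 _ (Subtype.coe_prop _)
    | @cons w c w' hwc p ih =>
      intro q q' hq hq'
      obtain ⟨z, hz, hz'⟩ := hadj w w.2 c c.2 hwc
      exact (h1 w w.2 q z hq hz).trans (ih z q' hz' hq')
  have hne : Nonempty {q | ∃ w ∈ X, q ∈ S w} := by
    obtain ⟨w⟩ := hX.nonempty
    obtain ⟨q⟩ := (hS w w.2).nonempty
    exact ⟨⟨q, w, w.2, q.2⟩⟩
  refine ⟨?_⟩
  rintro ⟨q, w, hw, hq⟩ ⟨q', w', hw', hq'⟩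
  obtain ⟨p⟩ := hX.preconnected ⟨w, hw⟩ ⟨w', hw'⟩
  exact h2 _ _ p q q' hq hq'

/-- The distance to a set of vertices that meets every component. -/
theorem exists_height {V : Type*} (G : SimpleGraph V) (S : Set V)
    (hS : ∀ v, ∃ s ∈ S, G.Reachable v s) : ∃ h : V → ℕ, (∀ s ∈ S, h s = 0) ∧
      (∀ a b, G.Adj a b → h a ≤ h b + 1) ∧ ∀ a ∉ S, ∃ b, G.Adj a b ∧ h a = h b + 1 := by
  let B : V → Set ℕ := fun v => {n | ∃ s ∈ S, ∃ p : G.Walk v s, p.length = n}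
  let h : V → ℕ := fun v => sInf (B v)
  have hle : ∀ v s, s ∈ S → ∀ p : G.Walk v s, h v ≤ p.length := by
    intro v s hs p
    have hp : p.length ∈ B v := ⟨s, hs, p, rfl⟩
    exact Nat.sInf_le hp
  have hex : ∀ v, ∃ s ∈ S, ∃ p : G.Walk v s, p.length = h v := by
    intro v
    obtain ⟨s, hs, ⟨p⟩⟩ := hS v
    have hp : p.length ∈ B v := ⟨s, hs, p, rfl⟩
    exact Nat.sInf_mem ⟨_, hp⟩
  have hadj : ∀ a b, G.Adj a b → h a ≤ h b + 1 := by
    intro a b hab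
    obtain ⟨s, hs, p, hp⟩ := hex b
    have := hle a s hs (SimpleGraph.Walk.cons hab p)
    rwa [SimpleGraph.Walk.length_cons, hp] at this
  refine ⟨h, fun s hs => Nat.le_zero.1 (hle s s hs SimpleGraph.Walk.nil), hadj, fun a ha => ?_⟩
  obtain ⟨s, hs, p, hp⟩ := hex a
  cases p with
  | nil => exact absurd hs ha
  | @cons _ b _ hab p =>
    have h1 := hle b s hs p
    have h2 := hadj a b hab
    rw [SimpleGraph.Walk.length_cons] at hp
    exact ⟨b, hab, by omega⟩

namespace AlmostEmbedding

variable {V : Type u} {G : SimpleGraph V} {g p k a : ℕ} (E : AlmostEmbedding G g p k a)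

/-- The facial cycle at which the `i`-th vortex is attached. -/
abbrev rim (i : Fin E.s) : G.Subgraph :=
  SimpleGraph.Subgraph.coeSubgraph (E.emb.boundary (E.face i))

/-- The vertices of the vortices. -/
def vortexVerts : Set V := {v | ∃ i, v ∈ (E.part i).verts}

theorem mem_rim {i : Fin E.s} {v : V} :
    v ∈ (E.rim i).verts ↔ ∃ x, E.emb.faceOf x = E.face i ∧ (x.1.fst : V) = v := by
  rw [SimpleGraph.Subgraph.verts_coeSubgraph]
  constructor
  · rintro ⟨w, ⟨x, hx, rfl⟩, rfl⟩
    exact ⟨x, hx, rfl⟩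
  · rintro ⟨x, hx, rfl⟩
    exact ⟨_, ⟨x, hx, rfl⟩, rfl⟩

theorem mem_rim_iff {i : Fin E.s} {v : V} :
    v ∈ (E.rim i).verts ↔ v ∈ E.G₀.verts ∧ v ∈ (E.part i).verts := by
  rw [← (E.vortex i).verts_inter, SimpleGraph.Subgraph.verts_inf]
  rfl

theorem notMem_apex_iff {v : V} : v ∉ E.apex ↔ v ∈ E.G₀.verts ∨ v ∈ E.vortexVerts := by
  have h := congrArg SimpleGraph.Subgraph.verts E.union_eq
  rw [SimpleGraph.Subgraph.verts_sup, SimpleGraph.Subgraph.verts_iSup] at h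
  have hv := Set.ext_iff.1 h v
  simp only [SimpleGraph.Subgraph.deleteVerts_verts, SimpleGraph.Subgraph.verts_top, Set.mem_sdiff,
    Set.mem_univ, true_and, Set.mem_union, Set.mem_iUnion] at hv
  exact hv

theorem adj_cases {x y : V} (h : G.Adj x y) (hx : x ∉ E.apex) (hy : y ∉ E.apex) :
    E.G₀.Adj x y ∨ ∃ i, (E.part i).Adj x y := by
  have h' : ((⊤ : G.Subgraph).deleteVerts E.apex).Adj x y := by
    rw [SimpleGraph.Subgraph.deleteVerts_adj]
    exact ⟨trivial, hx, trivial, hy, h⟩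
  rw [E.union_eq, SimpleGraph.Subgraph.sup_adj, SimpleGraph.Subgraph.iSup_adj] at h'
  exact h'

theorem part_unique {i j : Fin E.s} {v : V} (hi : v ∈ (E.part i).verts)
    (hj : v ∈ (E.part j).verts) : i = j := by
  by_contra hij
  exact Set.disjoint_left.1 (E.part_disjoint i j hij) hi hj

/-- A vertex together with its vortex bag, if it has one. -/
def blowUp (w : V) : Set V :=
  {v | v = w ∨ ∃ (i : Fin E.s) (hw : w ∈ (E.rim i).verts),
    ∃ y ∈ (E.vortex i).decomp.bag ⟨w, hw⟩, (y : V) = v}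

theorem blowUp_of_notMem {w : V} (hw : w ∈ E.G₀.verts) (hw' : w ∉ E.vortexVerts) :
    E.blowUp w = {w} := by
  ext v
  constructor
  · rintro (h | ⟨i, hi, -⟩)
    · exact h
    · exact absurd ⟨i, (E.mem_rim_iff.1 hi).2⟩ hw'
  · rintro rfl
    exact Or.inl rfl

theorem mem_blowUp {i : Fin E.s} {w v : V} (hw : w ∈ (E.rim i).verts) :
    v ∈ E.blowUp w ↔ ∃ y ∈ (E.vortex i).decomp.bag ⟨w, hw⟩, (y : V) = v := by
  constructor
  · rintro (rfl | ⟨j, hj, h⟩)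
    · exact (E.vortex i).mem_bag ⟨v, hw⟩
    · obtain rfl := E.part_unique (E.mem_rim_iff.1 hw).2 (E.mem_rim_iff.1 hj).2
      exact h
  · exact fun h => Or.inr ⟨i, hw, h⟩

theorem encard_blowUp_le {w : V} (hw : w ∈ E.G₀.verts) : (E.blowUp w).encard ≤ k + 1 := by
  by_cases hw' : w ∈ E.vortexVerts
  · obtain ⟨i, hi⟩ := hw'
    have hr : w ∈ (E.rim i).verts := E.mem_rim_iff.2 ⟨hw, hi⟩
    have h1 : E.blowUp w = Subtype.val '' (E.vortex i).decomp.bag ⟨w, hr⟩ := by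
      ext v
      exact E.mem_blowUp hr
    rw [h1, Subtype.val_injective.encard_image]
    have h2 := (E.vortex i).width_le
    unfold Decomposition.width at h2
    rw [tsub_le_iff_right] at h2
    exact (le_iSup (fun x => ((E.vortex i).decomp.bag x).encard) _).trans h2
  · rw [E.blowUp_of_notMem hw hw', Set.encard_singleton]
    exact le_add_self

/-- Vortices and apex vertices can be added to a tree decomposition of the embedded part. -/
theorem exists_decomposition_blowUp {N : Type*} {T : SimpleGraph N} (hT : T.IsTree)
    (D : Decomposition E.G₀.coe T) : ∃ D' : Decomposition G T, ∀ q,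
      D'.bag q = E.apex ∪ {v | ∃ w ∈ D.bag q, v ∈ E.blowUp w} := by
  have hrim : ∀ {i : Fin E.s} {w : V}, w ∈ (E.rim i).verts → w ∈ E.G₀.verts := fun h =>
    (E.mem_rim_iff.1 h).1
  have hset : ∀ (i : Fin E.s) (v : (E.part i).verts),
      {q | ∃ w ∈ D.bag q, v.1 ∈ E.blowUp w} =
      {q | ∃ x ∈ {x | v ∈ (E.vortex i).decomp.bag x}, q ∈ {q | ⟨x.1, hrim x.2⟩ ∈ D.bag q}} := by
    rintro i ⟨v, hv⟩
    ext q
    constructor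
    · rintro ⟨w, hwq, hvw⟩
      have hw : w.1 ∈ (E.rim i).verts := by
        rcases hvw with rfl | ⟨j, hj, y, hy, rfl⟩
        · exact E.mem_rim_iff.2 ⟨w.2, hv⟩
        · obtain rfl := E.part_unique hv y.2
          exact hj
      obtain ⟨y, hy, hyv⟩ := (E.mem_blowUp hw).1 hvw
      obtain rfl : y = ⟨v, hv⟩ := Subtype.ext hyv
      exact ⟨⟨w.1, hw⟩, hy, hwq⟩
    · rintro ⟨x, hx, hxq⟩
      exact ⟨_, hxq, (E.mem_blowUp x.2).2 ⟨_, hx, rfl⟩⟩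
  have hconn : ∀ v ∉ E.apex, (T.induce {q | ∃ w ∈ D.bag q, v ∈ E.blowUp w}).Connected := by
    intro v hv
    by_cases hvv : v ∈ E.vortexVerts
    · obtain ⟨i, hi⟩ := hvv
      rw [hset i ⟨v, hi⟩]
      -- The rim vertices whose vortex bags contain `v` are connected along the rim, and consecutive
      -- ones are adjacent in `G₀`, so they share a bag of `D`.
      refine connected_biUnion ((E.vortex i).decomp.connected ⟨v, hi⟩) _
        (fun x _ => D.connected _) fun x _ x' _ hxx' => ?_
      obtain ⟨q, hq, hq'⟩ := D.edge_mem ⟨x.1, hrim x.2⟩ ⟨x'.1, hrim x'.2⟩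
        ((SimpleGraph.Subgraph.coeSubgraph_le _).2 hxx')
      exact ⟨q, hq, hq'⟩
    · have hv₀ := (E.notMem_apex_iff.1 hv).resolve_right hvv
      have : {q | ∃ w ∈ D.bag q, v ∈ E.blowUp w} = {q | ⟨v, hv₀⟩ ∈ D.bag q} := by
        ext q
        constructor
        · rintro ⟨w, hw, rfl | ⟨i, -, y, -, rfl⟩⟩
          · exact hw
          · exact absurd ⟨i, y.2⟩ hvv
        · intro h
          exact ⟨_, h, Or.inl rfl⟩
      rw [this]
      exact D.connected _
  have hmem : ∀ v ∉ E.apex, ∃ q, ∃ w ∈ D.bag q, v ∈ E.blowUp w := by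
    intro v hv
    obtain ⟨q⟩ := (hconn v hv).nonempty
    exact ⟨q.1, q.2⟩
  refine ⟨⟨fun q => E.apex ∪ {v | ∃ w ∈ D.bag q, v ∈ E.blowUp w}, ?_, ?_⟩, fun _ => rfl⟩
  · intro x y hxy
    by_cases hx : x ∈ E.apex
    · by_cases hy : y ∈ E.apex
      · obtain ⟨q⟩ := hT.connected.nonempty
        exact ⟨q, Or.inl hx, Or.inl hy⟩
      · obtain ⟨q, hq⟩ := hmem y hy
        exact ⟨q, Or.inl hx, Or.inr hq⟩
    by_cases hy : y ∈ E.apex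
    · obtain ⟨q, hq⟩ := hmem x hx
      exact ⟨q, Or.inr hq, Or.inl hy⟩
    rcases E.adj_cases hxy hx hy with h | ⟨i, h⟩
    · obtain ⟨q, hq, hq'⟩ := D.edge_mem ⟨x, h.fst_mem⟩ ⟨y, h.snd_mem⟩ h
      exact ⟨q, Or.inr ⟨_, hq, Or.inl rfl⟩, Or.inr ⟨_, hq', Or.inl rfl⟩⟩
    · obtain ⟨z, hz, hz'⟩ := (E.vortex i).decomp.edge_mem ⟨x, h.fst_mem⟩ ⟨y, h.snd_mem⟩ h
      obtain ⟨q, hq⟩ := D.exists_mem_bag ⟨z.1, hrim z.2⟩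
      exact ⟨q, Or.inr ⟨_, hq, (E.mem_blowUp z.2).2 ⟨_, hz, rfl⟩⟩,
        Or.inr ⟨_, hq, (E.mem_blowUp z.2).2 ⟨_, hz', rfl⟩⟩⟩
  · intro v
    by_cases hv : v ∈ E.apex
    · have : {q | v ∈ E.apex ∪ {v | ∃ w ∈ D.bag q, v ∈ E.blowUp w}} = Set.univ :=
        Set.eq_univ_of_forall fun q => Or.inl hv
      rw [this]
      exact (SimpleGraph.induceUnivIso T).connected_iff.2 hT.connected
    · have : {q | v ∈ E.apex ∪ {v | ∃ w ∈ D.bag q, v ∈ E.blowUp w}} =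
          {q | ∃ w ∈ D.bag q, v ∈ E.blowUp w} := by
        ext q
        exact ⟨fun h => h.resolve_left hv, Or.inr⟩
      rw [this]
      exact hconn v hv

end AlmostEmbedding

/-! ### The layering and the forest of an almost embeddable graph -/

namespace AlmostEmbedding

variable {V : Type u} {G : SimpleGraph V} {g p k a : ℕ} (E : AlmostEmbedding G g p k a)

theorem adj_of_notMem_vortexVerts
    (hE : ∀ x ∈ E.apex, ∀ y ∈ E.G₀.verts, (∀ i, y ∉ (E.part i).verts) → ¬ G.Adj x y) {x y : V}
    (hx : x ∈ E.G₀.verts) (hxv : x ∉ E.vortexVerts) (hxy : G.Adj x y) : E.G₀.Adj x y := by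
  have hy : y ∉ E.apex := fun hy => hE y hy x hx (fun i hi => hxv ⟨i, hi⟩) hxy.symm
  rcases E.adj_cases hxy (E.notMem_apex_iff.2 (Or.inl hx)) hy with h | ⟨i, h⟩
  · exact h
  · exact absurd ⟨i, h.fst_mem⟩ hxv

/-- Layers beyond 0 are distances, so a vertex of `G₀` outside the vortices finds a parent in an
earlier layer. Within layer 0, the vertices of `K` outside the vortices all point to one of them,
lest they be too many roots. -/
theorem exists_rootedEmbedding [Finite V]
    (hE : ∀ x ∈ E.apex, ∀ y ∈ E.G₀.verts, (∀ i, y ∉ (E.part i).verts) → ¬ G.Adj x y) {K : Set V}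
    (hK : G.IsClique K) : ∃ (L : Layering G) (R : RootedEmbedding E.G₀.coe), L.layer 0 = K ∧
      R.emb = E.emb ∧ R.special.ncard ≤ p ∧
      R.roots.ncard ≤ Nat.card E.G₀.coe.ConnectedComponent ∧
      (∀ u w, R.parent u = some w → L.idx w ≤ L.idx u ∧ (1 ≤ L.idx u → L.idx w < L.idx u)) ∧
      ∀ u : E.G₀.verts, u.1 ∈ E.vortexVerts → R.parent u = none := by
  classical
  let S : Set V := {v | v ∈ K ∨ v ∈ E.apex ∨ v ∈ E.vortexVerts ∨ ∃ w ∈ K, G.Adj v w}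
  -- One vertex from each component of `G₀` that avoids `S`, so that `S ∪ M` is reachable from
  -- everywhere.
  let M : Set V := {v | ∃ c : E.G₀.coe.ConnectedComponent,
    (∀ u : E.G₀.verts, E.G₀.coe.connectedComponentMk u = c → u.1 ∉ S) ∧ v = c.out.1}
  obtain ⟨h, h0, hadj, hpos⟩ := exists_height G (S ∪ M) (by
    intro v
    by_cases hv : v ∈ S
    · exact ⟨v, Or.inl hv, SimpleGraph.Reachable.refl _⟩
    have hv₀ : v ∈ E.G₀.verts :=
      (E.notMem_apex_iff.1 fun hv' => hv (Or.inr (Or.inl hv'))).resolve_right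
        fun hv' => hv (Or.inr (Or.inr (Or.inl hv')))
    have hreach : ∀ u : E.G₀.verts, E.G₀.coe.connectedComponentMk u =
        E.G₀.coe.connectedComponentMk ⟨v, hv₀⟩ → G.Reachable v u.1 := fun u hu =>
      (SimpleGraph.ConnectedComponent.exact hu).symm.map E.G₀.hom
    by_cases hc : ∃ u : E.G₀.verts, E.G₀.coe.connectedComponentMk u =
        E.G₀.coe.connectedComponentMk ⟨v, hv₀⟩ ∧ u.1 ∈ S
    · obtain ⟨u, hu, huS⟩ := hc
      exact ⟨u, Or.inl huS, hreach u hu⟩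
    · push Not at hc
      exact ⟨_, Or.inr ⟨_, hc, rfl⟩, hreach _ (Quot.out_eq _)⟩)
  let idx : V → ℕ := fun v => if v ∈ K then 0 else h v + 1
  have hidxK : ∀ v, idx v = 0 ↔ v ∈ K := by
    intro v
    by_cases hv : v ∈ K <;> simp [idx, hv]
  have hidx : ∀ v ∉ K, idx v = h v + 1 := fun v hv => by simp [idx, hv]
  let L : Layering G := ⟨idx, fun x y hxy => by
    by_cases hx : x ∈ K
    · rw [(hidxK x).2 hx]
      omega
    by_cases hy : y ∈ K
    · rw [hidx x hx, h0 x (Or.inl (Or.inr (Or.inr (Or.inr ⟨y, hy, hxy⟩))))]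
      omega
    · rw [hidx x hx, hidx y hy]
      have := hadj x y hxy
      omega⟩
  -- The root, if any, to which the other such vertices of `K` point. Its rank is lowered to 0
  -- below, as layers alone do not decrease along these edges.
  obtain ⟨Q, hQ, hQs, hQne⟩ : ∃ Q : Set V, (∀ v ∈ Q, v ∈ K ∧ v ∈ E.G₀.verts ∧ v ∉ E.vortexVerts) ∧
      Q.Subsingleton ∧ ∀ v ∈ K, v ∈ E.G₀.verts → v ∉ E.vortexVerts → Q.Nonempty := by
    by_cases hex : ∃ v, v ∈ K ∧ v ∈ E.G₀.verts ∧ v ∉ E.vortexVerts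
    · obtain ⟨v, hv⟩ := hex
      exact ⟨{v}, by rintro _ rfl; exact hv, Set.subsingleton_singleton,
        fun _ _ _ _ => Set.singleton_nonempty v⟩
    · exact ⟨∅, by simp, Set.subsingleton_empty, fun v h1 h2 h3 => absurd ⟨v, h1, h2, h3⟩ hex⟩
  let rank : E.G₀.verts → ℕ := fun u => if u.1 ∈ Q then 0 else idx u + 1
  have hrank : ∀ u : E.G₀.verts, rank u ≤ idx u + 1 := by
    intro u
    by_cases hu : u.1 ∈ Q <;> simp [rank, hu]
  have hrank' : ∀ u : E.G₀.verts, u.1 ∉ Q → rank u = idx u + 1 := fun u hu => by simp [rank, hu]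
  have hpar : ∀ u : E.G₀.verts, ∃ o : Option E.G₀.verts,
      (∀ w, o = some w → E.G₀.coe.Adj u w ∧ rank w < rank u ∧
        (idx w ≤ idx u ∧ (1 ≤ idx u → idx w < idx u))) ∧
      (u.1 ∈ E.vortexVerts → o = none) ∧
      (o = none → u.1 ∈ E.vortexVerts ∨ u.1 ∈ M ∨ u.1 ∈ Q) := by
    intro u
    by_cases huv : u.1 ∈ E.vortexVerts
    · exact ⟨none, by simp, fun _ => rfl, fun _ => Or.inl huv⟩
    by_cases huM : u.1 ∈ M
    · exact ⟨none, by simp, fun _ => rfl, fun _ => Or.inr (Or.inl huM)⟩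
    by_cases huQ : u.1 ∈ Q
    · exact ⟨none, by simp, fun _ => rfl, fun _ => Or.inr (Or.inr huQ)⟩
    have main : ∃ w : E.G₀.verts, E.G₀.coe.Adj u w ∧ rank w < rank u ∧
        (idx w ≤ idx u ∧ (1 ≤ idx u → idx w < idx u)) := by
      by_cases huK : u.1 ∈ K
      · obtain ⟨w, hw⟩ := hQne u huK u.2 huv
        have hne : u.1 ≠ w := by
          rintro rfl
          exact huQ hw
        have hw' := hQ w hw
        refine ⟨⟨w, hw'.2.1⟩, E.adj_of_notMem_vortexVerts hE u.2 huv (hK huK hw'.1 hne), ?_, ?_, ?_⟩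
        · rw [hrank' u huQ]
          simp [rank, hw]
        · rw [(hidxK w).2 hw'.1]
          omega
        · rw [(hidxK u).2 huK]
          omega
      · have hlt : ∃ w : V, G.Adj u w ∧ idx w < idx u := by
          rw [hidx u huK]
          by_cases huS : u.1 ∈ S ∪ M
          · obtain ((hu | hu | hu | ⟨w, hw, huw⟩) | hu) := huS
            · exact absurd hu huK
            · exact absurd hu (E.notMem_apex_iff.2 (Or.inl u.2))
            · exact absurd hu huv
            · exact ⟨w, huw, by rw [(hidxK w).2 hw]; omega⟩
            · exact absurd hu huM
          · obtain ⟨w, huw, hw⟩ := hpos u huS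
            refine ⟨w, huw, ?_⟩
            by_cases hwK : w ∈ K
            · rw [(hidxK w).2 hwK]
              omega
            · rw [hidx w hwK]
              omega
        obtain ⟨w, huw, hlt⟩ := hlt
        have huw' := E.adj_of_notMem_vortexVerts hE u.2 huv huw
        have hr := hrank ⟨w, huw'.snd_mem⟩
        refine ⟨⟨w, huw'.snd_mem⟩, huw', ?_, hlt.le, fun _ => hlt⟩
        rw [hrank' u huQ]
        simp only at hr
        omega
    obtain ⟨w, hw⟩ := main
    refine ⟨some w, ?_, fun hu => absurd hu huv, by simp⟩
    rintro _ ⟨⟩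
    exact hw
  choose parent hp1 hp2 hp3 using hpar
  have hspecial : ∀ x i, E.emb.faceOf x = E.face i → x.1.fst.1 ∈ (E.part i).verts := fun x i hx =>
    (E.mem_rim_iff.1 (E.mem_rim.2 ⟨x, hx, rfl⟩)).2
  let R : RootedEmbedding E.G₀.coe :=
    { emb := E.emb
      special := Set.range E.face
      special_flag := by
        rintro x y ⟨i, hi⟩ ⟨j, hj⟩ hxy
        have hij : i = j := by
          refine E.part_unique (hspecial x i hi.symm) ?_
          rw [hxy]
          exact hspecial y j hj.symm
        subst hij
        exact (E.face_cycle i).1 x y hi.symm hj.symm hxy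
      parent := parent
      rank := rank
      parent_adj := fun u w huw => (hp1 u w huw).1
      parent_rank := fun u w huw => (hp1 u w huw).2.1
      parent_special := by
        rintro x ⟨i, hi⟩
        exact hp2 _ ⟨i, hspecial x i hi.symm⟩ }
  refine ⟨L, R, ?_, rfl, ?_, ?_, fun u w huw => (hp1 u w huw).2.2, hp2⟩
  · ext v
    exact hidxK v
  · have h1 : (Set.range E.face).ncard ≤ E.s := by
      rw [← Set.image_univ]
      refine (Set.ncard_image_le Set.finite_univ).trans ?_
      rw [Set.ncard_univ, Nat.card_eq_fintype_card, Fintype.card_fin]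
    exact h1.trans E.s_le
  · have hroots : ∀ u ∈ R.roots, u.1 ∈ M ∨ u.1 ∈ Q := by
      rintro u ⟨hu, hu'⟩
      refine (hp3 u hu).resolve_left ?_
      rintro ⟨i, hi⟩
      obtain ⟨x, hx, hxu⟩ := E.mem_rim.1 (E.mem_rim_iff.2 ⟨u.2, hi⟩)
      exact hu' ⟨x, ⟨i, hx.symm⟩, Subtype.ext hxu⟩
    rw [← Nat.card_coe_set_eq]
    refine Nat.card_le_card_of_injective
      (fun u : R.roots => E.G₀.coe.connectedComponentMk u.1) fun u u' huu => ?_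
    -- A root in `M` is determined by its component, which avoids `S` and hence `Q`; and `Q` has at
    -- most one element.
    have hMc : ∀ u : E.G₀.verts, u.1 ∈ M → u = (E.G₀.coe.connectedComponentMk u).out ∧
        ∀ u', E.G₀.coe.connectedComponentMk u' = E.G₀.coe.connectedComponentMk u → u'.1 ∉ S := by
      rintro u ⟨c, hc, hu⟩
      obtain rfl : u = c.out := Subtype.ext hu
      have hcc : E.G₀.coe.connectedComponentMk c.out = c := Quot.out_eq c
      rw [hcc]
      exact ⟨rfl, hc⟩
    change E.G₀.coe.connectedComponentMk u.1 = E.G₀.coe.connectedComponentMk u'.1 at huu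
    apply Subtype.ext
    rcases hroots u u.2 with hu | hu <;> rcases hroots u' u'.2 with hu' | hu'
    · rw [(hMc _ hu).1, (hMc _ hu').1, huu]
    · exact absurd (Or.inl (hQ _ hu').1) ((hMc _ hu).2 _ huu.symm)
    · exact absurd (Or.inl (hQ _ hu).1) ((hMc _ hu').2 _ huu)
    · exact Subtype.ext (hQs hu hu')

end AlmostEmbedding

/-! ### Layered width of the final decomposition -/

theorem RootedEmbedding.anc_total {U : Type*} {H : SimpleGraph U} {R : RootedEmbedding H}
    {u w w' : U} (h : R.Anc u w) (h' : R.Anc u w') : R.Anc w w' ∨ R.Anc w' w :=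
  Relation.ReflTransGen.total_of_right_unique
    (fun _ _ _ hb hc => Option.some_injective _ (hb.symm.trans hc)) h h'

namespace AlmostEmbedding

variable {V : Type u} {G : SimpleGraph V} {g p k a : ℕ} (E : AlmostEmbedding G g p k a)

/-- A path to the root has at most one vertex in layer `i`, and only its last vertex can be in a
vortex, so only one vertex is really blown up. Layer 0 is excluded because paths may have several
vertices there. -/
theorem encard_blowUp_anc_le {L : Layering G} {R : RootedEmbedding E.G₀.coe}
    (hR : ∀ u w, R.parent u = some w → L.idx w ≤ L.idx u ∧ (1 ≤ L.idx u → L.idx w < L.idx u))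
    (hR' : ∀ u : E.G₀.verts, u.1 ∈ E.vortexVerts → R.parent u = none) (u : E.G₀.verts) {i : ℕ}
    (hi : 1 ≤ i) :
    ({v | ∃ w, R.Anc u w ∧ v ∈ E.blowUp w} ∩ L.layer i).encard ≤ k + 1 := by
  have hmono : ∀ w w' : E.G₀.verts, R.Anc w w' → L.idx w' ≤ L.idx w := by
    intro w w' h
    induction h with
    | refl => exact le_rfl
    | tail _ h ih => exact (hR _ _ h).1.trans ih
  have hanc : ∀ w w' : E.G₀.verts, R.Anc w w' → L.idx w = i → L.idx w' = i → w = w' := by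
    intro w w' h hw hw'
    rcases Relation.ReflTransGen.cases_head h with h | ⟨c, hc, hcw⟩
    · exact h
    · have h1 := (hR _ _ hc).2 (by omega)
      have h2 := hmono _ _ hcw
      omega
  have huniq : ∀ w w' : E.G₀.verts, R.Anc u w → R.Anc u w' → L.idx w = i → L.idx w' = i →
      w = w' := by
    intro w w' h h' hw hw'
    rcases RootedEmbedding.anc_total h h' with h | h
    · exact hanc w w' h hw hw'
    · exact (hanc w' w h hw' hw).symm
  have hend : ∀ w w' : E.G₀.verts, R.Anc w w' → w.1 ∈ E.vortexVerts → w = w' := by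
    intro w w' h hw
    rcases Relation.ReflTransGen.cases_head h with h | ⟨c, hc, -⟩
    · exact h
    · rw [hR' w hw] at hc
      cases hc
  let C : Set V := {v | ∃ w : E.G₀.verts, R.Anc u w ∧ L.idx w = i ∧ w.1 = v}
  have hC : C.encard ≤ 1 := by
    rw [Set.encard_le_one_iff]
    rintro _ _ ⟨w, hw, hwi, rfl⟩ ⟨w', hw', hwi', rfl⟩
    rw [huniq w w' hw hw' hwi hwi']
  by_cases hex : ∃ w₀ : E.G₀.verts, R.Anc u w₀ ∧ w₀.1 ∈ E.vortexVerts
  · obtain ⟨w₀, hw₀, hw₀v⟩ := hex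
    have hcases : ∀ v, v ∈ {v | ∃ w, R.Anc u w ∧ v ∈ E.blowUp w} ∩ L.layer i →
        v ∈ E.blowUp w₀ ∨ v ∈ C := by
      rintro v ⟨⟨w, hw, hvw⟩, hvi⟩
      by_cases hwv : w.1 ∈ E.vortexVerts
      · left
        rcases RootedEmbedding.anc_total hw hw₀ with h | h
        · rwa [← hend w w₀ h hwv]
        · rwa [hend w₀ w h hw₀v]
      · right
        rw [E.blowUp_of_notMem w.2 hwv] at hvw
        obtain rfl := hvw
        exact ⟨w, hw, hvi, rfl⟩
    -- This keeps the bound at `k + 1` rather than `k + 2`: either `w₀` is itself the path vertex in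
    -- layer `i`, or it is outside this layer and its blow-up contributes at most `k`.
    by_cases hi₀ : L.idx w₀ = i
    · refine (Set.encard_le_encard fun v hv => ?_).trans (E.encard_blowUp_le w₀.2)
      rcases hcases v hv with h | ⟨w, hw, hwi, rfl⟩
      · exact h
      · rw [huniq w w₀ hw hw₀ hwi hi₀]
        exact Or.inl rfl
    · have hsub : {v | ∃ w, R.Anc u w ∧ v ∈ E.blowUp w} ∩ L.layer i ⊆
          (E.blowUp w₀ \ {w₀.1}) ∪ C := by
        intro v hv
        rcases hcases v hv with h | h
        · refine Or.inl ⟨h, ?_⟩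
          rintro rfl
          exact hi₀ hv.2
        · exact Or.inr h
      refine (Set.encard_le_encard hsub).trans ((Set.encard_union_le _ _).trans ?_)
      refine (add_le_add_right hC _).trans ?_
      have hw₀B : w₀.1 ∈ E.blowUp w₀ := Or.inl rfl
      rw [Set.encard_sdiff_singleton_add_one hw₀B]
      exact E.encard_blowUp_le w₀.2
  · push Not at hex
    refine (Set.encard_le_encard ?_).trans (hC.trans le_add_self)
    rintro v ⟨⟨w, hw, hvw⟩, hvi⟩
    rw [E.blowUp_of_notMem w.2 (hex w hw)] at hvw
    obtain rfl := hvw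
    exact ⟨w, hw, hvi, rfl⟩

end AlmostEmbedding

/-- In a layer `i ≥ 1`, a bag has at most `a` apex vertices and `k + 1` vertices from each of at
most `2(g+p)+3` paths; layer 0 is the clique, whose size is bounded by assumption. -/
theorem IsStronglyAlmostEmbeddable.isGood {V : Type u} [Finite V] {G : SimpleGraph V}
    {g p k a : ℕ} (h : IsStronglyAlmostEmbeddable G g p k a) :
    IsGood G (a + (2 * (g + p) + 3) * (k + 1)) := by
  obtain ⟨E, hE⟩ := h
  intro K hK hKl
  obtain ⟨L, R, hL, hemb, hs, hr, hR, hR'⟩ := E.exists_rootedEmbedding hE hK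
  obtain ⟨n, T, D, hT, hD⟩ := R.exists_decomposition (hemb ▸ E.genus_le) hs hr
  obtain ⟨D', hD'⟩ := E.exists_decomposition_blowUp hT D
  refine ⟨L, n, T, D', hL, hT, ?_⟩
  rw [D'.layeredWidth_le_iff]
  intro q i
  rcases Nat.eq_zero_or_pos i with rfl | hi
  · rw [hL]
    exact (Set.encard_le_encard Set.inter_subset_right).trans hKl
  obtain ⟨l, hl, hDq⟩ := hD q
  have hlfin : l.Finite := Set.toFinite l
  have hsub : D'.bag q ∩ L.layer i ⊆ E.apex ∪
      ⋃ u ∈ hlfin.toFinset, {v | ∃ w, R.Anc u w ∧ v ∈ E.blowUp w} ∩ L.layer i := by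
    rw [hD', hDq]
    rintro v ⟨hv | ⟨w, ⟨u, hu, huw⟩, hvw⟩, hvi⟩
    · exact Or.inl hv
    · right
      simp only [Set.mem_iUnion, Set.Finite.mem_toFinset]
      exact ⟨u, hu, ⟨w, huw, hvw⟩, hvi⟩
  refine (Set.encard_le_encard hsub).trans ((Set.encard_union_le _ _).trans ?_)
  rw [Nat.cast_add, Nat.cast_mul]
  refine add_le_add E.apex_card ((encard_biUnion_le _ _ _ fun u _ =>
    E.encard_blowUp_anc_le hR hR' u hi).trans ?_)
  rw [Nat.cast_add (R := ℕ∞) k 1, Nat.cast_one]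
  refine mul_le_mul_left (Nat.cast_le.2 ?_) _
  rwa [← Set.ncard_eq_toFinset_card l hlfin]

theorem ObtainedByCliqueSums.isGood {P : ∀ V : Type u, SimpleGraph V → Prop} {l : ℕ}
    (hP : ∀ (V : Type u) (G : SimpleGraph V), Finite V → P V G → IsGood G l) {V : Type u}
    {G : SimpleGraph V} (h : ObtainedByCliqueSums P V G) (hV : Finite V) : IsGood G l := by
  induction h with
  | base G h => exact hP _ G hV h
  | sum G₁ G₂ G _ _ h ih₁ ih₂ =>
    obtain ⟨f₁, f₂, -⟩ := id h
    exact (ih₁ (Finite.of_injective f₁ f₁.injective)).cliqueSum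
      (ih₂ (Finite.of_injective f₂ f₂.injective)) h

end LayeredSep

theorem mainTheorem3 {V : Type*} [Finite V] (G : SimpleGraph V) (k : ℕ) (hk : 1 ≤ k)
    (hG : LayeredSep.ObtainedByCliqueSums
      (fun _ H => LayeredSep.IsStronglyAlmostEmbeddable H k k k k) V G) :
    LayeredSep.IsGood G (4 * k ^ 2 + 8 * k + 3) ∧
    LayeredSep.layeredTreewidth G ≤ ((4 * k ^ 2 + 8 * k + 3 : ℕ) : ℕ∞) ∧
    LayeredSep.AdmitsLayeredSeparations G (4 * k ^ 2 + 8 * k + 3) ∧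
    (∀ d : ℕ, G.Connected → G.diam = d →
      LayeredSep.treewidth G < (((4 * k ^ 2 + 8 * k + 3) * (d + 1) : ℕ) : ℕ∞)) := by
  have h : LayeredSep.IsGood G (4 * k ^ 2 + 8 * k + 3) := by
    refine hG.isGood (fun V H hV hH => ?_) inferInstance
    have := hH.isGood
    rwa [show k + (2 * (k + k) + 3) * (k + 1) = 4 * k ^ 2 + 8 * k + 3 by ring] at this
  refine ⟨h, h.layeredTreewidth_le, h.admitsLayeredSeparations, ?_⟩
  rintro d hconn rfl
  exact h.treewidth_lt (by omega) hconn
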